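/- A Fano $4$-polyhedron is a convex polytope $P\subset\mathbb R^4$ (the convex hull of a finite set) such that: (i) all vertices of $P$ lie in $\mathbb Z^4$; (ii) $0$ lies in the interior of $P$; (iii) every proper face of $P$ is a simplex; (iv) the vertices of every $3$-dimensional face of $P$ form a $\mathbb Z$-basis of $\mathbb Z^4$. For a proper face $F$ of $P$ let $\sigma(F)$ be the cone of all nonnegative real linear combinations of the vertices of $F$, and let $\Sigma(P)$ be the fan consisting of $\{0\}$ and of all cones $\sigma(F)$, where $F$ runs over the nonempty proper faces of $P$. A set $C$ of vertices of $P$ is a primitive collection if $C$ is contained in no cone of $\Sigma(P)$, while every proper subset of $C$ is contained in some cone of $\Sigma(P)$. The valence of a vertex $v$ of $P$ is the number of vertices of $P$ that are joined to $v$ by an edge ($1$-dimensional face) of $P$, and $P$ is $2$-neighbourly if any two distinct vertices of $P$ are joined by an edge of $P$. Let $P$ be a Fano $4$-polyhedron. If every vertex of $P$ has valence at least $7$, then there is a primitive collection consisting of exactly two vertices of $P$; equivalently, $P$ is not $2$-neighbourly. (For every Fano $4$-polyhedron, whatever the valences of its vertices, a primitive collection with exactly two elements exists if and only if $P$ is not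 $2$-neighbourly.) -/

import Mathlib

/-- A convex polytope in `ℝ^d`: the convex hull of a finite set of points. -/
def IsConvexPolytope {d : ℕ} (P : Set (Fin d → ℝ)) : Prop :=
  ∃ S : Set (Fin d → ℝ), S.Finite ∧ P = convexHull ℝ S

/-- The set of vertices of a polytope, or of one of its faces. -/
def vertexSet {d : ℕ} (P : Set (Fin d → ℝ)) : Set (Fin d → ℝ) :=
  P.extremePoints ℝ

/-- Nonempty faces of a polytope `P`: the sets of points of `P` at which some linear functional
attains its maximum over `P` (the zero functional gives `P` itself). -/
def IsFace {d : ℕ} (P F : Set (Fin d → ℝ)) : Prop :=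
  F.Nonempty ∧ IsExposed ℝ P F

/-- Nonempty faces different from the polytope. -/
def IsProperFace {d : ℕ} (P F : Set (Fin d → ℝ)) : Prop :=
  IsFace P F ∧ F ≠ P

/-- The dimension of (the affine span of) a set. -/
noncomputable def faceDim {d : ℕ} (F : Set (Fin d → ℝ)) : ℕ :=
  Module.finrank ℝ (vectorSpan ℝ F)

/-- A simplex: the convex hull of its vertices, these being affinely independent. -/
def IsSimplex {d : ℕ} (F : Set (Fin d → ℝ)) : Prop :=
  AffineIndependent ℝ ((↑) : vertexSet F → (Fin d → ℝ)) ∧ F = convexHull ℝ (vertexSet F)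

/-- Fano polyhedra of dimension `d`. -/
structure IsFanoPolyhedron {d : ℕ} (P : Set (Fin d → ℝ)) : Prop where
  isConvexPolytope : IsConvexPolytope P
  /-- the vertices are lattice points -/
  vertex_integral : ∀ v ∈ vertexSet P, ∃ z : Fin d → ℤ, v = fun i => (z i : ℝ)
  zero_mem_interior : (0 : Fin d → ℝ) ∈ interior P
  simplicial : ∀ F, IsProperFace P F → IsSimplex F
  /-- the vertices of each facet are the rows of an integral matrix of determinant `±1`,
  that is, they form a `ℤ`-basis of `ℤ^d` -/
  facet_basis : ∀ F, IsProperFace P F → faceDim F + 1 = d →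
    ∃ A : Matrix (Fin d) (Fin d) ℤ, (A.det = 1 ∨ A.det = -1) ∧
      vertexSet F = Set.range (fun i : Fin d => fun j : Fin d => (A i j : ℝ))

/-- The cone `σ(F)` of all nonnegative real linear combinations of the vertices of `F`. -/
def faceCone {d : ℕ} (F : Set (Fin d → ℝ)) : PointedCone ℝ (Fin d → ℝ) :=
  PointedCone.hull ℝ (vertexSet F)

/-- The polyhedral fan `Σ(P)`: the zero cone and the cones over all proper faces. -/
def polyhedralFan {d : ℕ} (P : Set (Fin d → ℝ)) : Set (PointedCone ℝ (Fin d → ℝ)) :=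
  {⊥} ∪ {σ | ∃ F, IsProperFace P F ∧ σ = faceCone F}

/-- Primitive collections: sets of vertices that lie in no cone of the fan, while each proper
subset lies in some cone of the fan. -/
structure IsPrimitiveCollection {d : ℕ} (P C : Set (Fin d → ℝ)) : Prop where
  subset_vertexSet : C ⊆ vertexSet P
  not_subset_cone : ∀ σ ∈ polyhedralFan P, ¬ C ⊆ (σ : Set (Fin d → ℝ))
  proper_subset_cone : ∀ D, D ⊂ C → ∃ σ ∈ polyhedralFan P, D ⊆ (σ : Set (Fin d → ℝ))

/-- `v` and `w` are joined by an edge of `P`: the segment between them is a 1-dimensional face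
(in particular `v ≠ w`). -/
def JoinedByEdge {d : ℕ} (P : Set (Fin d → ℝ)) (v w : Fin d → ℝ) : Prop :=
  IsFace P (segment ℝ v w) ∧ faceDim (segment ℝ v w) = 1

/-- The valence of `v` in `P`: the number of vertices of `P` joined to `v` by an edge. -/
noncomputable def valence {d : ℕ} (P : Set (Fin d → ℝ)) (v : Fin d → ℝ) : ℕ :=
  {w | w ∈ vertexSet P ∧ JoinedByEdge P v w}.ncard

/-- `P` is 2-neighbourly: any two distinct vertices are joined by an edge. -/
def IsTwoNeighbourly {d : ℕ} (P : Set (Fin d → ℝ)) : Prop :=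
  ∀ v ∈ vertexSet P, ∀ w ∈ vertexSet P, v ≠ w → JoinedByEdge P v w

/-! A vertex is never joined to itself, so valence at least 7 forces at least 8 vertices. It
therefore suffices that a 2-neighbourly Fano 4-polyhedron has at most 7 vertices (`card_le_seven`).

Neighbourliness enters only through additive relations. An edge functional attains its maximum `c >
0` over the vertices exactly at `v` and `w`. Hence `v + w` is neither zero nor a vertex, and `v + w
= x + y` forces `x` to be `v` or `w`. These facts, together with the existence of facet bases and of
neighbouring ones, form `IsNeighbourlyConfig`; the counting argument uses nothing else.

Each facet is a lattice basis and gives an integral height, equal to 1 on the facet and at most 0 at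
all other vertices. Let `s` be the sum of all vertices and choose a facet whose cone contains `s`
(`exists_special_facet`). Then `s` has nonnegative height, so the negative heights add up to at
least -4. Crossing a ridge shows that a vertex of height 0 has coordinates at least -1, that at
least two of them are negative, and that two such vertices are never negative at the same index. So
at most two vertices have height 0.

With 8 vertices, few height distributions remain, according to whether two, one or no vertices have
height 0. Each is refuted by comparing coordinates in neighbouring facets, often with the help of `s
= 0`, which holds when the negative heights add up to exactly -4. -/

/-- The sum of the coordinates of `v` in the basis `b`. -/
noncomputable def height {M : Type*} [AddCommGroup M] (b : Module.Basis (Fin 4) ℤ M) (v : M) : ℤ :=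
  b.repr v 0 + b.repr v 1 + b.repr v 2 + b.repr v 3

/-- A lattice basis contained in `V` such that all other elements of `V` have height `≤ 0`. -/
structure IsFacetBasis {M : Type*} [AddCommGroup M] (V : Finset M)
    (b : Module.Basis (Fin 4) ℤ M) : Prop where
  mem : ∀ i, b i ∈ V
  height_nonpos : ∀ v ∈ V, v ∉ Set.range b → height b v ≤ 0

/-- Combinatorial properties of the vertex set of a `2`-neighbourly Fano `4`-polyhedron. -/
structure IsNeighbourlyConfig {M : Type*} [AddCommGroup M] (V : Finset M) : Prop where
  exists_facet : ∃ b : Module.Basis (Fin 4) ℤ M, IsFacetBasis V b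
  exists_adjacent : ∀ b : Module.Basis (Fin 4) ℤ M, IsFacetBasis V b → ∀ i,
    ∃ b' : Module.Basis (Fin 4) ℤ M, IsFacetBasis V b' ∧ b' i ≠ b i ∧ ∀ j, j ≠ i → b' j = b j
  add_ne_zero : ∀ v ∈ V, ∀ w ∈ V, v ≠ w → v + w ≠ 0
  add_notMem : ∀ v ∈ V, ∀ w ∈ V, v ≠ w → v + w ∉ V
  eq_of_add_eq_add : ∀ v ∈ V, ∀ w ∈ V, v ≠ w → ∀ x ∈ V, ∀ y ∈ V, v + w = x + y → x = v ∨ x = w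

/-! ### Coordinates in a facet basis and crossing a ridge -/

section Combinatorics

variable {M : Type*} [AddCommGroup M] {V : Finset M} {b b' : Module.Basis (Fin 4) ℤ M}

lemma height_sum (b : Module.Basis (Fin 4) ℤ M) (S : Finset M) :
    height b (∑ v ∈ S, v) = ∑ v ∈ S, height b v := by
  simp [height, Finset.sum_add_distrib, map_sum]

lemma height_basis (b : Module.Basis (Fin 4) ℤ M) (i : Fin 4) : height b (b i) = 1 := by
  fin_cases i <;> simp [height]

lemma eq_of_coords (b : Module.Basis (Fin 4) ℤ M) {v w : M} (h0 : b.repr v 0 = b.repr w 0)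
    (h1 : b.repr v 1 = b.repr w 1) (h2 : b.repr v 2 = b.repr w 2)
    (h3 : b.repr v 3 = b.repr w 3) : v = w := by
  apply b.repr.injective
  ext i
  fin_cases i <;> assumption

lemma height_reindex (b : Module.Basis (Fin 4) ℤ M) (σ : Equiv.Perm (Fin 4)) (v : M) :
    height (b.reindex σ) v = height b v := by
  have h : ∀ b : Module.Basis (Fin 4) ℤ M, height b v = ∑ i, b.repr v i := by
    intro b; rw [Fin.sum_univ_four]; rfl
  rw [h, h]
  simp only [Module.Basis.repr_reindex_apply]
  exact Equiv.sum_comp σ.symm (fun i => b.repr v i)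

lemma IsFacetBasis.reindex (hb : IsFacetBasis V b) (σ : Equiv.Perm (Fin 4)) :
    IsFacetBasis V (b.reindex σ) where
  mem i := by simpa using hb.mem _
  height_nonpos v hv h := by
    rw [height_reindex]
    exact hb.height_nonpos v hv (by simpa [Module.Basis.range_reindex] using h)

/-- Change of coordinates when the `i`-th basis vector is replaced. -/
lemma repr_eq_of_replace {i : Fin 4} (h : ∀ j, j ≠ i → b' j = b j) (v : M) :
    b.repr v i = b.repr (b' i) i * b'.repr v i ∧
    ∀ j, j ≠ i → b.repr v j = b'.repr v j + b.repr (b' i) j * b'.repr v i := by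
  have hv : ∀ k, b.repr v k = ∑ j, b'.repr v j * b.repr (b' j) k := by
    intro k
    conv_lhs => rw [← b'.sum_repr v, map_sum, Finsupp.finsetSum_apply]
    exact Finset.sum_congr rfl fun j _ => by simp
  have hj : ∀ k j, j ≠ i → b.repr (b' j) k = if j = k then 1 else 0 := by
    intro k j hji
    rw [h j hji, b.repr_self, Finsupp.single_apply]
  constructor
  · rw [hv, Finset.sum_eq_single i]
    · ring
    · intro j _ hji
      rw [hj i j hji, if_neg hji, mul_zero]
    · simp
  · intro j hji
    rw [hv, ← Finset.add_sum_erase _ _ (Finset.mem_univ i),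
      Finset.sum_eq_single_of_mem j (by simp [hji])]
    · rw [hj j j hji, if_pos rfl]; ring
    · intro k hk hkj
      rw [hj j k (by simpa using hk), if_neg hkj, mul_zero]

/-- `b'` is the facet basis adjacent to `b` across the `i`-th vertex. -/
structure IsAdjacent (V : Finset M) (b b' : Module.Basis (Fin 4) ℤ M) (i : Fin 4) : Prop where
  isFacetBasis : IsFacetBasis V b'
  eq_of_ne : ∀ j, j ≠ i → b' j = b j
  notMem : b' i ∉ Set.range b
  repr_new : b.repr (b' i) i = -1
  repr_self : ∀ v, b'.repr v i = - b.repr v i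
  repr_ne : ∀ v j, j ≠ i → b'.repr v j = b.repr v j + b.repr (b' i) j * b.repr v i
  height_eq : ∀ v, height b' v = height b v + (height b (b' i) - 1) * b.repr v i

lemma height_eq_sum (b : Module.Basis (Fin 4) ℤ M) (v : M) : height b v = ∑ i, b.repr v i := by
  rw [Fin.sum_univ_four]; rfl

lemma exists_isAdjacent (hV : IsNeighbourlyConfig V) (hb : IsFacetBasis V b) (i : Fin 4) :
    ∃ b', IsAdjacent V b b' i := by
  obtain ⟨b', hb', hne, heq⟩ := hV.exists_adjacent b hb i
  have hnot : b' i ∉ Set.range b := by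
    rintro ⟨j, hj⟩
    by_cases hji : j = i
    · subst hji; exact hne hj.symm
    · rw [← heq j hji] at hj
      exact hji (b'.injective hj)
  have hnot' : b i ∉ Set.range b' := by
    rintro ⟨j, hj⟩
    by_cases hji : j = i
    · subst hji; exact hne hj
    · rw [heq j hji] at hj
      exact hji (b.injective hj)
  have hp := hb.height_nonpos _ (hb'.mem i) hnot
  have hq := hb'.height_nonpos _ (hb.mem i) hnot'
  have hrep := fun v => repr_eq_of_replace heq v
  have hsum : ∀ v, height b v = height b' v + (height b (b' i) - 1) * b'.repr v i := by
    intro v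
    rw [height_eq_sum, height_eq_sum, height_eq_sum, ← Finset.add_sum_erase _ _ (Finset.mem_univ i),
      ← Finset.add_sum_erase _ (fun k => b'.repr v k) (Finset.mem_univ i),
      ← Finset.add_sum_erase _ (fun k => b.repr (b' i) k) (Finset.mem_univ i), (hrep v).1,
      Finset.sum_congr rfl (fun j hj => (hrep v).2 j (by simpa using hj)), Finset.sum_add_distrib,
      ← Finset.sum_mul]
    ring
  have hunit := (hrep (b i)).1
  rw [b.repr_self, Finsupp.single_eq_same] at hunit
  have h1 := hsum (b i)
  rw [height_basis] at h1
  -- The coordinate is a unit of `ℤ`. The value 1 would give `1 = height b' (b i) + height b (b' i)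
  -- - 1 ≤ -1`.
  have hnew : b.repr (b' i) i = -1 := by
    rcases Int.eq_one_or_neg_one_of_mul_eq_one hunit.symm with h | h
    · rw [h, one_mul] at hunit
      rw [← hunit] at h1
      omega
    · exact h
  have hself : ∀ v, b'.repr v i = - b.repr v i := by
    intro v
    rw [(hrep v).1, hnew]; ring
  refine ⟨b', hb', heq, hnot, hnew, hself, ?_, ?_⟩
  · intro v j hj
    rw [(hrep v).2 j hj, hself v]; ring
  · intro v
    rw [hsum v, hself v]; ring

namespace IsAdjacent

variable {i : Fin 4}

lemma height_new_nonpos (hb : IsFacetBasis V b) (h : IsAdjacent V b b' i) :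
    height b (b' i) ≤ 0 :=
  hb.height_nonpos _ (h.isFacetBasis.mem i) h.notMem

lemma height_nonpos (h : IsAdjacent V b b' i) {v : M} (hv : v ∈ V)
    (hvb : height b v ≤ 0) (hne : v ≠ b' i) : height b' v ≤ 0 := by
  apply h.isFacetBasis.height_nonpos v hv
  rintro ⟨j, rfl⟩
  by_cases hji : j = i
  · exact hne (by rw [hji])
  · rw [h.eq_of_ne j hji, height_basis] at hvb
    omega

/-- Crossing the `i`-th ridge adds a negative multiple of the `i`-th coordinate to the height. So
`v` gets positive height over the neighbouring facet and must be one of its vertices. -/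
lemma eq_new_of_height_zero (hb : IsFacetBasis V b) (h : IsAdjacent V b b' i) {v : M} (hv : v ∈ V)
    (h0 : height b v = 0) (hneg : b.repr v i < 0) : v = b' i := by
  by_contra hne
  have h1 := h.height_nonpos hv h0.le hne
  rw [h.height_eq, h0] at h1
  have h2 := h.height_new_nonpos hb
  nlinarith

end IsAdjacent

/-! ### Negative coordinates of vertices of height 0 and -1 -/

lemma repr_ge_of_height_zero (hV : IsNeighbourlyConfig V) (hb : IsFacetBasis V b) {v : M}
    (hv : v ∈ V) (h0 : height b v = 0) (i : Fin 4) : -1 ≤ b.repr v i := by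
  by_contra hlt
  obtain ⟨b', h⟩ := exists_isAdjacent hV hb i
  have := h.eq_new_of_height_zero hb hv h0 (by omega)
  rw [this, h.repr_new] at hlt
  omega

/-- Both vertices are the new vertex of the facet across the `i`-th ridge. -/
lemma eq_of_repr_neg (hV : IsNeighbourlyConfig V) (hb : IsFacetBasis V b) {v w : M}
    (hv : v ∈ V) (hw : w ∈ V) (h0 : height b v = 0) (h0' : height b w = 0) {i : Fin 4}
    (hi : b.repr v i < 0) (hi' : b.repr w i < 0) : v = w := by
  obtain ⟨b', h⟩ := exists_isAdjacent hV hb i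
  rw [h.eq_new_of_height_zero hb hv h0 hi, h.eq_new_of_height_zero hb hw h0' hi']

lemma zero_notMem (hV : IsNeighbourlyConfig V) : (0 : M) ∉ V := by
  intro h
  obtain ⟨b, hb⟩ := hV.exists_facet
  exact hV.add_notMem 0 h _ (hb.mem 0) (b.ne_zero 0).symm (by simpa using hb.mem 0)

/-- The indices of the negative coordinates of `v`. -/
noncomputable def negIndices (b : Module.Basis (Fin 4) ℤ M) (v : M) : Finset (Fin 4) :=
  Finset.univ.filter fun i => b.repr v i < 0

lemma mem_negIndices {v : M} {i : Fin 4} : i ∈ negIndices b v ↔ b.repr v i < 0 := by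
  simp [negIndices]

/-- No element of `V` is the negative of a basis vector. -/
lemma ne_neg_basis (hV : IsNeighbourlyConfig V) (hb : IsFacetBasis V b) {v : M} (hv : v ∈ V)
    (hle : height b v ≤ 0) (i : Fin 4) (hi : b.repr v i = -1)
    (h : ∀ j, j ≠ i → b.repr v j = 0) : False := by
  apply hV.add_ne_zero v hv (b i) (hb.mem i) (fun h' => by rw [h', height_basis] at hle; omega)
  apply b.repr.injective
  ext j
  by_cases hj : j = i
  · subst hj; simp [hi]
  · simp [h j hj, Ne.symm hj]

lemma ne_sub_basis (hV : IsNeighbourlyConfig V) (hb : IsFacetBasis V b) {v : M} (hv : v ∈ V)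
    (hle : height b v ≤ 0) (i j : Fin 4) (h : v + b i = b j) : False := by
  refine hV.add_notMem v hv (b i) (hb.mem i)
    (fun h' => by rw [h', height_basis] at hle; omega) ?_
  rw [h]; exact hb.mem j

/-- If only coordinate 0 is negative, it equals -1 and the others are nonnegative with sum 1 or 0.
Then `v` is `b j - b 0` or `-b 0`, and adding `b 0` gives a vertex or zero, which neighbourliness
forbids. -/
lemma exists_second_neg_zero (hV : IsNeighbourlyConfig V) (hb : IsFacetBasis V b) {v : M}
    (hv : v ∈ V) (h : height b v = 0 ∨ height b v = -1) (hge : ∀ i, -1 ≤ b.repr v i)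
    (hneg : b.repr v 0 < 0) : ∃ j, j ≠ 0 ∧ b.repr v j < 0 := by
  by_contra! H
  have h1 := H 1 (by decide)
  have h2 := H 2 (by decide)
  have h3 := H 3 (by decide)
  have h0 := hge 0
  have hle : height b v ≤ 0 := by omega
  have key : ∀ j, b.repr v 0 = b.repr (b j) 0 - b.repr (b 0) 0 →
      b.repr v 1 = b.repr (b j) 1 - b.repr (b 0) 1 →
      b.repr v 2 = b.repr (b j) 2 - b.repr (b 0) 2 →
      b.repr v 3 = b.repr (b j) 3 - b.repr (b 0) 3 → False := by
    intro j e0 e1 e2 e3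
    refine ne_sub_basis hV hb hv hle 0 j (eq_of_coords b ?_ ?_ ?_ ?_) <;>
    · rw [map_add, Finsupp.add_apply]; omega
  rcases h with h | h
  · unfold height at h
    have : b.repr v 1 = 1 ∧ b.repr v 2 = 0 ∧ b.repr v 3 = 0 ∨
        b.repr v 1 = 0 ∧ b.repr v 2 = 1 ∧ b.repr v 3 = 0 ∨
        b.repr v 1 = 0 ∧ b.repr v 2 = 0 ∧ b.repr v 3 = 1 := by omega
    rcases this with ⟨e1, e2, e3⟩ | ⟨e1, e2, e3⟩ | ⟨e1, e2, e3⟩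
    · apply key 1 <;> simp [e1, e2, e3]; omega
    · apply key 2 <;> simp [e1, e2, e3]; omega
    · apply key 3 <;> simp [e1, e2, e3]; omega
  · unfold height at h
    apply ne_neg_basis hV hb hv hle 0 (by omega)
    intro j hj
    fin_cases j <;> simp at hj ⊢ <;> omega

lemma exists_second_neg (hV : IsNeighbourlyConfig V) (hb : IsFacetBasis V b) {v : M}
    (hv : v ∈ V) (h : height b v = 0 ∨ height b v = -1) (hge : ∀ i, -1 ≤ b.repr v i) (i : Fin 4)
    (hneg : b.repr v i < 0) : ∃ j, j ≠ i ∧ b.repr v j < 0 := by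
  obtain ⟨j, hj, hj'⟩ := exists_second_neg_zero hV (hb.reindex (Equiv.swap 0 i)) hv
    (by simpa [height_reindex] using h) (fun j => by simpa using hge _) (by simpa using hneg)
  refine ⟨Equiv.swap 0 i j, fun h' => hj ?_, by simpa using hj'⟩
  rw [Equiv.swap_apply_eq_iff] at h'
  simpa using h'

lemma exists_two_neg (hV : IsNeighbourlyConfig V) (hb : IsFacetBasis V b) {v : M}
    (hv : v ∈ V) (h : height b v = 0 ∨ height b v = -1) (hge : ∀ i, -1 ≤ b.repr v i) :
    ∃ i j, i ≠ j ∧ b.repr v i < 0 ∧ b.repr v j < 0 := by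
  have : ∃ i, b.repr v i < 0 := by
    by_contra! H
    have h0 := H 0
    have h1 := H 1
    have h2 := H 2
    have h3 := H 3
    unfold height at h
    apply zero_notMem hV
    convert hv
    apply eq_of_coords b <;> simp <;> omega
  obtain ⟨i, hi⟩ := this
  obtain ⟨j, hj, hj'⟩ := exists_second_neg hV hb hv h hge i hi
  exact ⟨i, j, hj.symm, hi, hj'⟩

lemma two_neg_cases {f : Fin 4 → ℤ} (h : ∃ i j, i ≠ j ∧ f i < 0 ∧ f j < 0) :
    (f 0 < 0 ∧ f 1 < 0) ∨ (f 0 < 0 ∧ f 2 < 0) ∨ (f 0 < 0 ∧ f 3 < 0) ∨ (f 1 < 0 ∧ f 2 < 0) ∨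
      (f 1 < 0 ∧ f 3 < 0) ∨ (f 2 < 0 ∧ f 3 < 0) := by
  obtain ⟨i, j, hij, hi, hj⟩ := h
  fin_cases i <;> fin_cases j <;> simp at hij hi hj <;> tauto

lemma zero_height_cases (hV : IsNeighbourlyConfig V) (hb : IsFacetBasis V b) {v : M}
    (hv : v ∈ V) (h : height b v = 0) :
    (b.repr v 0 < 0 ∧ b.repr v 1 < 0) ∨ (b.repr v 0 < 0 ∧ b.repr v 2 < 0) ∨
      (b.repr v 0 < 0 ∧ b.repr v 3 < 0) ∨ (b.repr v 1 < 0 ∧ b.repr v 2 < 0) ∨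
      (b.repr v 1 < 0 ∧ b.repr v 3 < 0) ∨ (b.repr v 2 < 0 ∧ b.repr v 3 < 0) :=
  two_neg_cases (exists_two_neg hV hb hv (Or.inl h) (repr_ge_of_height_zero hV hb hv h))

/-- The sets of negative indices are disjoint subsets of a four-element set, each with at least two
elements. -/
lemma card_le_two_of_disjoint_neg (S : Finset M)
    (htwo : ∀ v ∈ S, ∃ i j, i ≠ j ∧ b.repr v i < 0 ∧ b.repr v j < 0)
    (huniq : ∀ v ∈ S, ∀ w ∈ S, ∀ i, b.repr v i < 0 → b.repr w i < 0 → v = w) : S.card ≤ 2 := by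
  classical
  have hdisj : (S : Set M).PairwiseDisjoint (negIndices b) := by
    intro v hv w hw hne
    refine Finset.disjoint_left.2 fun i hi hi' => hne ?_
    exact huniq v hv w hw i (mem_negIndices.1 hi) (mem_negIndices.1 hi')
  have h1 := Finset.card_biUnion hdisj
  have h2 : (S.biUnion (negIndices b)).card ≤ 4 := by
    simpa using Finset.card_le_univ (S.biUnion (negIndices b))
  have h3 : S.card * 2 ≤ ∑ v ∈ S, (negIndices b v).card := by
    rw [← smul_eq_mul]
    refine Finset.card_nsmul_le_sum _ _ _ fun v hv => ?_
    obtain ⟨i, j, hij, hi, hj⟩ := htwo v hv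
    exact Finset.one_lt_card.2 ⟨i, mem_negIndices.2 hi, j, mem_negIndices.2 hj, hij⟩
  omega

lemma card_height_zero_le (hV : IsNeighbourlyConfig V) (hb : IsFacetBasis V b) :
    (V.filter fun v => height b v = 0).card ≤ 2 := by
  apply card_le_two_of_disjoint_neg (b := b)
  · intro v hv
    rw [Finset.mem_filter] at hv
    exact exists_two_neg hV hb hv.1 (Or.inl hv.2) (repr_ge_of_height_zero hV hb hv.1 hv.2)
  · intro v hv w hw i hi hi'
    rw [Finset.mem_filter] at hv hw
    exact eq_of_repr_neg hV hb hv.1 hw.1 hv.2 hw.2 hi hi'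

/-- Every lattice vector lies in the cone over some facet. -/
lemma exists_special_facet (hV : IsNeighbourlyConfig V) (s : M) :
    ∃ b, IsFacetBasis V b ∧ ∀ i, 0 ≤ b.repr s i := by
  have hfin : {b : Module.Basis (Fin 4) ℤ M | IsFacetBasis V b}.Finite := by
    refine Set.Finite.of_injOn (f := fun b : Module.Basis (Fin 4) ℤ M => (b : Fin 4 → M))
      (t := {f : Fin 4 → M | ∀ i, f i ∈ V}) ?_ ?_ ?_
    · intro b hb
      exact hb.mem
    · intro b _ b' _ h
      exact Module.Basis.eq_of_apply_eq (fun i => congrFun h i)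
    · exact Set.Finite.pi' fun _ => V.finite_toSet
  -- Take the facet over which `s` is highest: crossing a ridge where `s` has a negative coordinate
  -- would increase its height.
  obtain ⟨b, hb, hmax⟩ := Set.exists_max_image _ (fun b => height b s) hfin hV.exists_facet
  refine ⟨b, hb, fun i => ?_⟩
  by_contra! hi
  obtain ⟨b', h⟩ := exists_isAdjacent hV hb i
  have h1 := hmax b' h.isFacetBasis
  rw [h.height_eq] at h1
  have := h.height_new_nonpos hb
  nlinarith

/-- Two elements of height zero, in the normal form that can be reached by a permutation. -/
structure IsZeroPair (V : Finset M) (b : Module.Basis (Fin 4) ℤ M) (x y : M) : Prop where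
  isFacetBasis : IsFacetBasis V b
  left_mem : x ∈ V
  right_mem : y ∈ V
  left_zero : b.repr x 0 = -1
  left_one : b.repr x 1 = -1
  left_two : 0 ≤ b.repr x 2
  left_three : 0 ≤ b.repr x 3
  left_add : b.repr x 2 + b.repr x 3 = 2
  right_zero : 0 ≤ b.repr y 0
  right_one : 0 ≤ b.repr y 1
  right_two : b.repr y 2 = -1
  right_three : b.repr y 3 = -1
  right_add : b.repr y 0 + b.repr y 1 = 2

/-! ### Two vertices of height 0 -/

namespace IsZeroPair

variable {x y w : M}

lemma left_height (h : IsZeroPair V b x y) : height b x = 0 := by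
  have := h.left_zero
  have := h.left_one
  have := h.left_add
  unfold height; omega

lemma right_height (h : IsZeroPair V b x y) : height b y = 0 := by
  have := h.right_two
  have := h.right_three
  have := h.right_add
  unfold height; omega

/-- The permutation exchanging the two vertices. -/
def flipPerm : Equiv.Perm (Fin 4) := Equiv.swap 0 2 * Equiv.swap 1 3

lemma swap_left (h : IsZeroPair V b x y) :
    IsZeroPair V (b.reindex (Equiv.swap 0 1)) x y := by
  have e0 : Equiv.swap (0 : Fin 4) 1 0 = 1 := by decide
  have e1 : Equiv.swap (0 : Fin 4) 1 1 = 0 := by decide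
  have e2 : Equiv.swap (0 : Fin 4) 1 2 = 2 := by decide
  have e3 : Equiv.swap (0 : Fin 4) 1 3 = 3 := by decide
  obtain ⟨h0, h1, h2, h3, h4, h5, h6, h7, h8, h9, h10, h11, h12⟩ := h
  refine ⟨h0.reindex _, h1, h2, ?_, ?_, ?_, ?_, ?_, ?_, ?_, ?_, ?_, ?_⟩ <;>
    simp only [Module.Basis.repr_reindex_apply, Equiv.symm_swap, e0, e1, e2, e3] <;> omega

lemma flip (h : IsZeroPair V b x y) : IsZeroPair V (b.reindex flipPerm) y x := by
  have e0 : flipPerm.symm 0 = 2 := by decide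
  have e1 : flipPerm.symm 1 = 3 := by decide
  have e2 : flipPerm.symm 2 = 0 := by decide
  have e3 : flipPerm.symm 3 = 1 := by decide
  obtain ⟨h0, h1, h2, h3, h4, h5, h6, h7, h8, h9, h10, h11, h12⟩ := h
  refine ⟨h0.reindex _, h2, h1, ?_, ?_, ?_, ?_, ?_, ?_, ?_, ?_, ?_, ?_⟩ <;>
    simp only [Module.Basis.repr_reindex_apply, e0, e1, e2, e3] <;> omega

/-- The new vertex across ridge 0 is `x`, because `x` has height 0 and is negative there. This makes
the change of coordinates explicit. -/
lemma adjacent_zero (h : IsZeroPair V b x y) (hadj : IsAdjacent V b b' 0) :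
    x = b' 0 ∧ (∀ v, height b' v = height b v - b.repr v 0) ∧
    ∀ v, b'.repr v 0 = - b.repr v 0 ∧ b'.repr v 1 = b.repr v 1 - b.repr v 0 ∧
      b'.repr v 2 = b.repr v 2 + b.repr x 2 * b.repr v 0 ∧
      b'.repr v 3 = b.repr v 3 + b.repr x 3 * b.repr v 0 := by
  have hx := hadj.eq_new_of_height_zero h.isFacetBasis h.left_mem h.left_height
    (by rw [h.left_zero]; norm_num)
  refine ⟨hx, fun v => ?_, fun v => ⟨hadj.repr_self v, ?_, ?_, ?_⟩⟩
  · rw [hadj.height_eq, ← hx, h.left_height]; ring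
  · rw [hadj.repr_ne v 1 (by decide), ← hx, h.left_one]; ring
  · rw [hadj.repr_ne v 2 (by decide), ← hx]
  · rw [hadj.repr_ne v 3 (by decide), ← hx]

/-- Over the facet across ridge 0 the height of `w` is `-k - b.repr w 0`, which is nonnegative and
hence 0. There the old vertex `b 0` also has height 0 and already occupies the negative indices 0
and 1, so `w` is -1 at indices 2 and 3. Translating back gives the formulas. -/
lemma coord_zero (hV : IsNeighbourlyConfig V) (h : IsZeroPair V b x y) (hw : w ∈ V)
    {k : ℤ} (hk : 1 ≤ k) (hwk : height b w = -k) (hw0 : b.repr w 0 ≤ -k) :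
    b.repr w 0 = -k ∧ b.repr w 1 = 2 - 2 * k ∧ b.repr w 2 = b.repr x 2 * k - 1 ∧
      b.repr w 3 = b.repr x 3 * k - 1 ∧ 1 ≤ b.repr y 0 := by
  obtain ⟨b', hadj⟩ := exists_isAdjacent hV h.isFacetBasis 0
  obtain ⟨hx, hht, hrep⟩ := h.adjacent_zero hadj
  have hb' := hadj.isFacetBasis
  have hne : w ≠ b' 0 := by
    rintro rfl
    rw [← hx, h.left_height] at hwk; omega
  have hle := hadj.height_nonpos hw (by omega) hne
  rw [hht] at hle
  have hwk0 : b.repr w 0 = -k := by omega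
  have hw' : height b' w = 0 := by rw [hht]; omega
  have he' : height b' (b 0) = 0 := by rw [hht, height_basis]; simp
  have hwe : w ≠ b 0 := by
    rintro rfl
    rw [height_basis] at hwk; omega
  have he1 : b'.repr (b 0) 1 < 0 := by rw [(hrep (b 0)).2.1]; simp
  obtain ⟨r0, r1, r2, r3⟩ := hrep w
  rw [hwk0] at r0 r1 r2 r3
  have hw1 : 0 ≤ b'.repr w 1 := by
    by_contra! hlt
    exact hwe (eq_of_repr_neg hV hb' hw (h.isFacetBasis.mem 0) hw' he' hlt he1)
  have hcases := zero_height_cases hV hb' hw hw'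
  have g2 := repr_ge_of_height_zero hV hb' hw hw' 2
  have g3 := repr_ge_of_height_zero hV hb' hw hw' 3
  have hsum := hw'
  unfold height at hsum
  have n2 : b'.repr w 2 = -1 := by omega
  have n3 : b'.repr w 3 = -1 := by omega
  refine ⟨hwk0, by omega, by linarith, by linarith, ?_⟩
  -- If `y` had coordinate 0 here, it would keep height 0 and the entry -1 at index 2 after the
  -- crossing, and so would coincide with `w`.
  by_contra! hlt
  have hy0 : b.repr y 0 = 0 := by have := h.right_zero; omega
  have hy' : height b' y = 0 := by rw [hht, h.right_height, hy0]; rfl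
  have hy2 : b'.repr y 2 = -1 := by rw [(hrep y).2.2.1, hy0, h.right_two]; ring
  have := eq_of_repr_neg hV hb' hw h.right_mem hw' hy' (i := 2) (by omega) (by omega)
  rw [this, h.right_height] at hwk
  omega

lemma coord_one (hV : IsNeighbourlyConfig V) (h : IsZeroPair V b x y) (hw : w ∈ V)
    {k : ℤ} (hk : 1 ≤ k) (hwk : height b w = -k) (hw0 : b.repr w 1 ≤ -k) :
    b.repr w 1 = -k ∧ b.repr w 0 = 2 - 2 * k ∧ b.repr w 2 = b.repr x 2 * k - 1 ∧
      b.repr w 3 = b.repr x 3 * k - 1 ∧ 1 ≤ b.repr y 1 := by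
  have e0 : Equiv.swap (0 : Fin 4) 1 0 = 1 := by decide
  have e1 : Equiv.swap (0 : Fin 4) 1 1 = 0 := by decide
  have e2 : Equiv.swap (0 : Fin 4) 1 2 = 2 := by decide
  have e3 : Equiv.swap (0 : Fin 4) 1 3 = 3 := by decide
  have := h.swap_left.coord_zero hV hw hk (by rwa [height_reindex])
  simp only [Module.Basis.repr_reindex_apply, Equiv.symm_swap, e0, e1, e2, e3] at this
  exact this hw0

lemma coord_two (hV : IsNeighbourlyConfig V) (h : IsZeroPair V b x y) (hw : w ∈ V)
    {k : ℤ} (hk : 1 ≤ k) (hwk : height b w = -k) (hw0 : b.repr w 2 ≤ -k) :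
    b.repr w 2 = -k ∧ b.repr w 3 = 2 - 2 * k ∧ b.repr w 0 = b.repr y 0 * k - 1 ∧
      b.repr w 1 = b.repr y 1 * k - 1 ∧ 1 ≤ b.repr x 2 := by
  have e0 : flipPerm.symm 0 = 2 := by decide
  have e1 : flipPerm.symm 1 = 3 := by decide
  have e2 : flipPerm.symm 2 = 0 := by decide
  have e3 : flipPerm.symm 3 = 1 := by decide
  have := h.flip.coord_zero hV hw hk (by rwa [height_reindex])
  simp only [Module.Basis.repr_reindex_apply, e0, e1, e2, e3] at this
  exact this hw0

lemma coord_three (hV : IsNeighbourlyConfig V) (h : IsZeroPair V b x y) (hw : w ∈ V)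
    {k : ℤ} (hk : 1 ≤ k) (hwk : height b w = -k) (hw0 : b.repr w 3 ≤ -k) :
    b.repr w 3 = -k ∧ b.repr w 2 = 2 - 2 * k ∧ b.repr w 0 = b.repr y 0 * k - 1 ∧
      b.repr w 1 = b.repr y 1 * k - 1 ∧ 1 ≤ b.repr x 3 := by
  have e0 : flipPerm.symm 0 = 2 := by decide
  have e1 : flipPerm.symm 1 = 3 := by decide
  have e2 : flipPerm.symm 2 = 0 := by decide
  have e3 : flipPerm.symm 3 = 1 := by decide
  have := h.flip.coord_one hV hw hk (by rwa [height_reindex])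
  simp only [Module.Basis.repr_reindex_apply, e0, e1, e2, e3] at this
  exact this hw0

/-- With `k = 1` in `coord_zero`, `w` is `(-1, 0, x₂ - 1, x₃ - 1)`. If `x₂` or `x₃` vanishes,
`coord_two` or `coord_three` is contradicted; otherwise both are 1 and `w = -b 0`. -/
lemma zero_nonneg_of_height_neg_one (hV : IsNeighbourlyConfig V) (h : IsZeroPair V b x y)
    (hw : w ∈ V) (hwk : height b w = -1) : 0 ≤ b.repr w 0 := by
  by_contra! hlt
  obtain ⟨h0, h1, h2, h3, h4⟩ := h.coord_zero hV hw le_rfl hwk (by omega)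
  have hxa := h.left_add
  have hx2 := h.left_two
  have hx3 := h.left_three
  by_cases hc2 : b.repr x 2 = 0
  · have := (h.coord_two hV hw le_rfl hwk (by omega)).2.2.2.2
    omega
  by_cases hc3 : b.repr x 3 = 0
  · have := (h.coord_three hV hw le_rfl hwk (by omega)).2.2.2.2
    omega
  apply ne_neg_basis hV h.isFacetBasis hw (by omega) 0 h0
  intro j hj
  fin_cases j <;> simp at hj ⊢ <;> omega

lemma height_ne_neg_one (hV : IsNeighbourlyConfig V) (h : IsZeroPair V b x y)
    (hw : w ∈ V) : height b w ≠ -1 := by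
  intro hwk
  have e0 : flipPerm.symm 0 = 2 := by decide
  have e1 : flipPerm.symm 1 = 3 := by decide
  have h0 := h.zero_nonneg_of_height_neg_one hV hw hwk
  have h1 := h.swap_left.zero_nonneg_of_height_neg_one hV hw (by rwa [height_reindex])
  have h2 := h.flip.zero_nonneg_of_height_neg_one hV hw (by rwa [height_reindex])
  have h3 := h.flip.swap_left.zero_nonneg_of_height_neg_one hV hw
    (by rwa [height_reindex, height_reindex])
  simp only [Module.Basis.repr_reindex_apply, Equiv.symm_swap, Equiv.swap_apply_left, e0, e1]
    at h1 h2 h3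
  unfold height at hwk
  omega

/-- A value of -2 or less is excluded by `coord_zero`. If the value is -1, then `w` has height -1
over the facet across ridge 0. Since `y` is unchanged there, that facet has the zero pair `b 0`,
`y`, which excludes height -1. -/
lemma zero_nonneg_of_height_neg_two (hV : IsNeighbourlyConfig V) (h : IsZeroPair V b x y)
    (hw : w ∈ V) (hwk : height b w = -2) (hy : b.repr y 0 = 0) : 0 ≤ b.repr w 0 := by
  by_contra! hlt
  have hw0 : b.repr w 0 = -1 := by
    by_contra hne
    have := (h.coord_zero hV hw (by norm_num) hwk (by omega)).2.2.2.2
    omega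
  obtain ⟨b', hadj⟩ := exists_isAdjacent hV h.isFacetBasis 0
  obtain ⟨hx, hht, hrep⟩ := h.adjacent_zero hadj
  have hpair : IsZeroPair V b' (b 0) y := by
    obtain ⟨r0, r1, r2, r3⟩ := hrep y
    obtain ⟨s0, s1, s2, s3⟩ := hrep (b 0)
    simp [hy] at r0 r1 r2 r3
    simp at s0 s1 s2 s3
    obtain ⟨h0, h1, h2, h3, h4, h5, h6, h7, h8, h9, h10, h11, h12⟩ := h
    refine ⟨hadj.isFacetBasis, h0.mem 0, h2, ?_, ?_, ?_, ?_, ?_, ?_, ?_, ?_, ?_, ?_⟩ <;> omega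
  exact hpair.height_ne_neg_one hV hw (by rw [hht]; omega)

/-- Lower bounds for the first coordinate at height `-2`. -/
lemma zero_bounds (hV : IsNeighbourlyConfig V) (h : IsZeroPair V b x y)
    (hw : w ∈ V) (hwk : height b w = -2) :
    (1 ≤ b.repr y 0 ∨ 0 ≤ b.repr w 0) ∧ (-1 ≤ b.repr w 0 ∨ (b.repr w 0 = -2 ∧ b.repr w 1 = -2 ∧
      b.repr w 2 = 2 * b.repr x 2 - 1 ∧ b.repr w 3 = 2 * b.repr x 3 - 1)) := by
  constructor
  · have h0 := h.right_zero
    rcases h0.eq_or_lt with h0 | h0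
    · exact Or.inr (h.zero_nonneg_of_height_neg_two hV hw hwk h0.symm)
    · exact Or.inl h0
  · rcases lt_or_ge (b.repr w 0) (-1) with h0 | h0
    · obtain ⟨h1, h2, h3, h4, h5⟩ := h.coord_zero hV hw (by norm_num) hwk (by omega)
      exact Or.inr ⟨h1, by omega, by omega, by omega⟩
    · exact Or.inl h0

lemma pair_cases {c w v : ℤ} (hc : 0 ≤ c) (hc2 : c ≤ 2) (h : w + v + c = 0)
    (k : 1 ≤ c ∨ 0 ≤ w) (l : 1 ≤ c ∨ 0 ≤ v) (m : -1 ≤ w) (n : -1 ≤ v) :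
    (c = 0 ∧ w = 0 ∧ v = 0) ∨ (c = 2 ∧ w = -1 ∧ v = -1) ∨ (c = 1 ∧ w = -1 ∧ v = 0) ∨
      (c = 1 ∧ w = 0 ∧ v = -1) := by
  omega

/-- The arithmetic behind `not_two_height_neg_two`. -/
lemma arithmetic_contradiction {a a' c c' w₀ w₁ w₂ w₃ v₀ v₁ v₂ v₃ : ℤ}
    (ha : 0 ≤ a) (ha' : 0 ≤ a') (haa : a + a' = 2) (hc : 0 ≤ c) (hc' : 0 ≤ c') (hcc : c + c' = 2)
    (hac : ¬ (a = 1 ∧ a' = 1 ∧ c = 1 ∧ c' = 1))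
    (h0 : w₀ + v₀ + c = 0) (h1 : w₁ + v₁ + c' = 0) (h2 : w₂ + v₂ + a = 0) (h3 : w₃ + v₃ + a' = 0)
    (k0 : 1 ≤ c ∨ 0 ≤ w₀) (k1 : 1 ≤ c' ∨ 0 ≤ w₁) (k2 : 1 ≤ a ∨ 0 ≤ w₂) (k3 : 1 ≤ a' ∨ 0 ≤ w₃)
    (l0 : 1 ≤ c ∨ 0 ≤ v₀) (l1 : 1 ≤ c' ∨ 0 ≤ v₁) (l2 : 1 ≤ a ∨ 0 ≤ v₂) (l3 : 1 ≤ a' ∨ 0 ≤ v₃)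
    (m0 : -1 ≤ w₀) (m1 : -1 ≤ w₁) (m2 : -1 ≤ w₂) (m3 : -1 ≤ w₃)
    (n0 : -1 ≤ v₀) (n1 : -1 ≤ v₁) (n2 : -1 ≤ v₂) (n3 : -1 ≤ v₃)
    (s : w₀ + w₁ + w₂ + w₃ = -2)
    (hne : ¬ (w₀ = v₀ ∧ w₁ = v₁ ∧ w₂ = v₂ ∧ w₃ = v₃))
    (r01 : ¬ (w₀ + 1 = v₀ ∧ w₁ = v₁ + 1 ∧ w₂ = v₂ ∧ w₃ = v₃))
    (r10 : ¬ (w₀ = v₀ + 1 ∧ w₁ + 1 = v₁ ∧ w₂ = v₂ ∧ w₃ = v₃))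
    (r23 : ¬ (w₀ = v₀ ∧ w₁ = v₁ ∧ w₂ + 1 = v₂ ∧ w₃ = v₃ + 1))
    (r32 : ¬ (w₀ = v₀ ∧ w₁ = v₁ ∧ w₂ = v₂ + 1 ∧ w₃ + 1 = v₃)) : False := by
  obtain p0 := pair_cases hc (by omega) h0 k0 l0 m0 n0
  obtain p1 := pair_cases hc' (by omega) h1 k1 l1 m1 n1
  obtain p2 := pair_cases ha (by omega) h2 k2 l2 m2 n2
  obtain p3 := pair_cases ha' (by omega) h3 k3 l3 m3 n3
  clear h0 h1 h2 h3 k0 k1 k2 k3 l0 l1 l2 l3 m0 m1 m2 m3 n0 n1 n2 n3 ha ha' hc hc'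
  rcases p0 with ⟨rfl, rfl, rfl⟩ | ⟨rfl, rfl, rfl⟩ | ⟨rfl, rfl, rfl⟩ | ⟨rfl, rfl, rfl⟩ <;>
  rcases p1 with ⟨rfl, rfl, rfl⟩ | ⟨rfl, rfl, rfl⟩ | ⟨rfl, rfl, rfl⟩ | ⟨rfl, rfl, rfl⟩ <;>
  first
    | exact absurd hcc (by decide)
    | (rcases p2 with ⟨rfl, rfl, rfl⟩ | ⟨rfl, rfl, rfl⟩ | ⟨rfl, rfl, rfl⟩ | ⟨rfl, rfl, rfl⟩ <;>
        rcases p3 with ⟨rfl, rfl, rfl⟩ | ⟨rfl, rfl, rfl⟩ | ⟨rfl, rfl, rfl⟩ | ⟨rfl, rfl, rfl⟩ <;>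
        revert haa hac s hne r01 r10 r23 r32 <;> decide)

/-- The four equations say that all vertices sum to zero. Each coordinate then leaves at most two
possibilities for `w` and `w'`, so the two vertices are equal, or `w + b i = w' + b j` for some `i ≠
j`, or `x + y = 0`. -/
lemma not_two_height_neg_two (hV : IsNeighbourlyConfig V) (h : IsZeroPair V b x y) {w' : M}
    (hw : w ∈ V) (hw' : w' ∈ V) (hwk : height b w = -2) (hwk' : height b w' = -2) (hne : w ≠ w')
    (h0 : b.repr w 0 + b.repr w' 0 + b.repr y 0 = 0)
    (h1 : b.repr w 1 + b.repr w' 1 + b.repr y 1 = 0)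
    (h2 : b.repr w 2 + b.repr w' 2 + b.repr x 2 = 0)
    (h3 : b.repr w 3 + b.repr w' 3 + b.repr x 3 = 0) : False := by
  have e0 : flipPerm.symm 0 = 2 := by decide
  have e1 : flipPerm.symm 1 = 3 := by decide
  have e2 : flipPerm.symm 2 = 0 := by decide
  have e3 : flipPerm.symm 3 = 1 := by decide
  have f2 : Equiv.swap (0 : Fin 4) 1 2 = 2 := by decide
  have f3 : Equiv.swap (0 : Fin 4) 1 3 = 3 := by decide
  have key := fun v (hv : v ∈ V) (hvk : height b v = -2) =>
    And.intro (h.zero_bounds hV hv hvk) <| And.intro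
      (h.swap_left.zero_bounds hV hv (by rwa [height_reindex])) <| And.intro
      (h.flip.zero_bounds hV hv (by rwa [height_reindex]))
      (h.flip.swap_left.zero_bounds hV hv (by rwa [height_reindex, height_reindex]))
  simp only [Module.Basis.repr_reindex_apply, Equiv.symm_swap, Equiv.swap_apply_left,
    Equiv.swap_apply_right, e0, e1, e2, e3, f2, f3] at key
  have hxy : ¬ (b.repr x 2 = 1 ∧ b.repr x 3 = 1 ∧ b.repr y 0 = 1 ∧ b.repr y 1 = 1) := by
    rintro ⟨t1, t2, t3, t4⟩
    refine hV.add_ne_zero x h.left_mem y h.right_mem ?_ ?_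
    · rintro rfl
      have := h.left_zero
      omega
    · have := h.left_zero
      have := h.left_one
      have := h.right_two
      have := h.right_three
      apply eq_of_coords b <;> simp <;> omega
  have a2 := h.left_two
  have a3 := h.left_three
  have aa := h.left_add
  have c0 := h.right_zero
  have c1 := h.right_one
  have cc := h.right_add
  obtain ⟨⟨k0, m0⟩, ⟨k1, m1⟩, ⟨k2, m2⟩, ⟨k3, m3⟩⟩ := key w hw hwk
  obtain ⟨⟨l0, n0⟩, ⟨l1, n1⟩, ⟨l2, n2⟩, ⟨l3, n3⟩⟩ := key w' hw' hwk'
  -- A coordinate -2 of one vertex fixes all its coordinates by `zero_bounds`. The zero sum then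
  -- pushes the other vertex below its own bounds, unless `x = -y`, which `hxy` excludes.
  have q0 : -1 ≤ b.repr w 0 := by omega
  have q1 : -1 ≤ b.repr w 1 := by omega
  have q2 : -1 ≤ b.repr w 2 := by omega
  have q3 : -1 ≤ b.repr w 3 := by omega
  have p0 : -1 ≤ b.repr w' 0 := by omega
  have p1 : -1 ≤ b.repr w' 1 := by omega
  have p2 : -1 ≤ b.repr w' 2 := by omega
  have p3 : -1 ≤ b.repr w' 3 := by omega
  have s := hwk
  unfold height at s
  have hdiff : ¬ (b.repr w 0 = b.repr w' 0 ∧ b.repr w 1 = b.repr w' 1 ∧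
      b.repr w 2 = b.repr w' 2 ∧ b.repr w 3 = b.repr w' 3) :=
    fun ⟨t0, t1, t2, t3⟩ => hne (eq_of_coords b t0 t1 t2 t3)
  have hrel : ∀ i j, i ≠ j → w + b i ≠ w' + b j := by
    intro i j hij heq
    have hb := h.isFacetBasis
    rcases hV.eq_of_add_eq_add w hw (b i) (hb.mem i)
      (fun h' => by rw [h', height_basis] at hwk; omega) _ hw' _ (hb.mem j) heq with h' | h'
    · exact hne h'.symm
    · rw [h', height_basis] at hwk'; omega
  have hcoord : ∀ i j, i ≠ j → ¬ (b.repr (w + b i) 0 = b.repr (w' + b j) 0 ∧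
      b.repr (w + b i) 1 = b.repr (w' + b j) 1 ∧ b.repr (w + b i) 2 = b.repr (w' + b j) 2 ∧
      b.repr (w + b i) 3 = b.repr (w' + b j) 3) :=
    fun i j hij ⟨t0, t1, t2, t3⟩ => hrel i j hij (eq_of_coords b t0 t1 t2 t3)
  have r01 := hcoord 0 1 (by decide)
  have r10 := hcoord 1 0 (by decide)
  have r23 := hcoord 2 3 (by decide)
  have r32 := hcoord 3 2 (by decide)
  simp only [map_add, Finsupp.add_apply, Module.Basis.repr_self, Finsupp.single_apply,
    Fin.reduceEq, if_true, if_false, add_zero] at r01 r10 r23 r32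
  exact arithmetic_contradiction a2 a3 aa c0 c1 cc hxy h0 h1 h2 h3 k0 k1 k2 k3 l0 l1 l2 l3
    q0 q1 q2 q3 p0 p1 p2 p3 s hdiff r01 r10 r23 r32

end IsZeroPair

/-- Lower bound for the coordinates of a vertex of height `-1`. -/
lemma IsAdjacent.repr_nonneg_of_height_neg_one {i : Fin 4}
    (h : IsAdjacent V b b' i) (hlt : height b (b' i) < 0) {w : M} (hw : w ∈ V)
    (hwk : height b w = -1) (hne : w ≠ b' i) : 0 ≤ b.repr w i := by
  by_contra! hneg
  have h1 := h.height_nonpos hw (by omega) hne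
  rw [h.height_eq, hwk] at h1
  nlinarith

/-- The new vertex has `i`-th coordinate -1, so it cannot be `x`, the only possible vertex of height
0. -/
lemma IsAdjacent.height_new_neg {i : Fin 4} (hb : IsFacetBasis V b)
    (h : IsAdjacent V b b' i) {x : M} (hx0 : ∀ z ∈ V, height b z = 0 → z = x)
    (hxi : 0 ≤ b.repr x i) : height b (b' i) < 0 := by
  refine lt_of_le_of_ne (h.height_new_nonpos hb) fun h0 => ?_
  have := hx0 _ (h.isFacetBasis.mem i) h0
  rw [← this, h.repr_new] at hxi
  omega

/-! ### One vertex of height 0 -/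

section OneZero

variable {x u v q : M}

/-- Only the new vertex across the `i`-th ridge can contribute negatively, and it contributes -1. -/
lemma sum_repr_ge {i : Fin 4} (h : IsAdjacent V b b' i)
    (hlt : height b (b' i) < 0) (N : Finset M) (hN : ∀ w ∈ N, w ∈ V ∧ height b w = -1) :
    -1 ≤ ∑ w ∈ N, b.repr w i := by
  classical
  have h1 : ∑ w ∈ N, (if w = b' i then (-1 : ℤ) else 0) ≤ ∑ w ∈ N, b.repr w i := by
    refine Finset.sum_le_sum fun w hw => ?_
    split_ifs with hwi
    · rw [hwi, h.repr_new]
    · exact h.repr_nonneg_of_height_neg_one hlt (hN w hw).1 (hN w hw).2 hwi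
  rw [Finset.sum_ite_eq'] at h1
  refine le_trans ?_ h1
  split_ifs <;> norm_num

/-- The configuration with a single vertex `x` of height zero and negative vertices `u`, `v`, `q`
of heights `-1`, `-1`, `-2`, the sum of all vertices being zero. -/
structure IsOneZero (V : Finset M) (b : Module.Basis (Fin 4) ℤ M) (x u v q : M) : Prop where
  isFacetBasis : IsFacetBasis V b
  x_mem : x ∈ V
  u_mem : u ∈ V
  v_mem : v ∈ V
  q_mem : q ∈ V
  x_height : height b x = 0
  u_height : height b u = -1
  v_height : height b v = -1
  q_height : height b q = -2
  u_ne_v : u ≠ v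
  eq_x : ∀ z ∈ V, height b z = 0 → z = x
  eq_of_neg : ∀ z ∈ V, height b z < 0 → z = u ∨ z = v ∨ z = q
  sum_eq : ∀ i, 1 + b.repr x i + b.repr u i + b.repr v i + b.repr q i = 0

namespace IsOneZero

lemma swap (h : IsOneZero V b x u v q) : IsOneZero V b x v u q := by
  obtain ⟨h1, h2, h3, h4, h5, h6, h7, h8, h9, h10, h11, h12, h13⟩ := h
  exact ⟨h1, h2, h4, h3, h5, h6, h8, h7, h9, h10.symm, h11,
    fun z hz hz' => by have := h12 z hz hz'; tauto, fun i => by have := h13 i; omega⟩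

lemma reindex (h : IsOneZero V b x u v q) (σ : Equiv.Perm (Fin 4)) :
    IsOneZero V (b.reindex σ) x u v q := by
  obtain ⟨h1, h2, h3, h4, h5, h6, h7, h8, h9, h10, h11, h12, h13⟩ := h
  refine ⟨h1.reindex σ, h2, h3, h4, h5, ?_, ?_, ?_, ?_, h10, ?_, ?_, ?_⟩ <;>
    simp only [height_reindex, Module.Basis.repr_reindex_apply] <;> first | assumption | skip
  exact fun i => h13 _

/-- Coordinates at an index where `x` is nonnegative. -/
lemma repr_cases (hV : IsNeighbourlyConfig V) (h : IsOneZero V b x u v q) {i : Fin 4}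
    (hi : 0 ≤ b.repr x i) : b.repr x i = 0 ∨ (b.repr x i = 1 ∧ b.repr q i = -1 ∧
      (b.repr u i = -1 ∧ b.repr v i = 0 ∨ b.repr u i = 0 ∧ b.repr v i = -1)) := by
  have hb := h.isFacetBasis
  obtain ⟨b', hadj⟩ := exists_isAdjacent hV hb i
  have hlt := hadj.height_new_neg hb h.eq_x hi
  have hs := h.sum_eq i
  have hu : u ≠ b' i → 0 ≤ b.repr u i :=
    hadj.repr_nonneg_of_height_neg_one hlt h.u_mem h.u_height
  have hv : v ≠ b' i → 0 ≤ b.repr v i :=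
    hadj.repr_nonneg_of_height_neg_one hlt h.v_mem h.v_height
  have hnew := hadj.repr_new
  -- When the new vertex has height -1, the height of `q` over the new facet is `-2 - 2 * b.repr q
  -- i`, and it must be at most 0.
  have hq : b' i = u ∨ b' i = v → -1 ≤ b.repr q i := by
    intro hp
    have hp1 : height b (b' i) = -1 := by
      rcases hp with hp | hp <;> rw [hp]
      exacts [h.u_height, h.v_height]
    have hne : q ≠ b' i := by
      intro h'
      rw [← h', h.q_height] at hp1
      omega
    have h1 := hadj.height_nonpos h.q_mem (by have := h.q_height; omega) hne
    rw [hadj.height_eq, hp1, h.q_height] at h1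
    omega
  rcases h.eq_of_neg _ (hadj.isFacetBasis.mem i) hlt with hp | hp | hp
  · have h1 := hq (Or.inl hp)
    have h2 := hv (by rw [hp]; exact h.u_ne_v.symm)
    rw [hp] at hnew
    omega
  · have h1 := hq (Or.inr hp)
    have h2 := hu (by rw [hp]; exact h.u_ne_v)
    rw [hp] at hnew
    omega
  · have h1 := hu (by rw [hp]; intro h'; have := h.u_height; rw [h', h.q_height] at this; omega)
    have h2 := hv (by rw [hp]; intro h'; have := h.v_height; rw [h', h.q_height] at this; omega)
    rw [hp] at hnew
    omega

/-- Crossing ridge 0 brings in `x` and raises `q` to height 0, but its coordinate at index 2 becomes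
`-1 - 2 = -3`, below the bound -1. -/
lemma q_repr_ne (hV : IsNeighbourlyConfig V) (h : IsOneZero V b x u v q) (hx0 : b.repr x 0 = -1)
    (hx2 : b.repr x 2 = 1) (hq0 : b.repr q 0 = -2) (hq2 : b.repr q 2 = -1) : False := by
  obtain ⟨b', hadj⟩ := exists_isAdjacent hV h.isFacetBasis 0
  have hx := hadj.eq_new_of_height_zero h.isFacetBasis h.x_mem h.x_height (by omega)
  have hh := hadj.height_eq q
  rw [← hx, h.x_height, h.q_height, hq0] at hh
  have := repr_ge_of_height_zero hV hadj.isFacetBasis h.q_mem (by rw [hh]; norm_num) 2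
  rw [hadj.repr_ne q 2 (by decide), ← hx, hx2, hq0, hq2] at this
  omega

lemma repr_ge {i : Fin 4} (hV : IsNeighbourlyConfig V) (h : IsOneZero V b x u v q)
    (hx : b.repr x i < 0) : -1 ≤ b.repr u i ∧ -1 ≤ b.repr v i := by
  obtain ⟨b', hadj⟩ := exists_isAdjacent hV h.isFacetBasis i
  have hx' := hadj.eq_new_of_height_zero h.isFacetBasis h.x_mem h.x_height hx
  have key : ∀ w ∈ V, height b w = -1 → -1 ≤ b.repr w i := by
    intro w hw hwk
    have := hadj.height_nonpos hw (by omega) (by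
      rintro rfl
      rw [← hx', h.x_height] at hwk
      omega)
    rw [hadj.height_eq, ← hx', h.x_height, hwk] at this
    omega
  exact ⟨key u h.u_mem h.u_height, key v h.v_mem h.v_height⟩

/-- The case that the two vertices of height `-1` are negative at the indices `2` and `3`
respectively. -/
lemma false_of_split (hV : IsNeighbourlyConfig V) (h : IsOneZero V b x u v q)
    (hx0 : b.repr x 0 = -1) (hx1 : b.repr x 1 = -1) (hx2 : b.repr x 2 = 1)
    (hq2 : b.repr q 2 = -1) (hq3 : b.repr q 3 = -1)
    (hu2 : b.repr u 2 = -1) (hv2 : b.repr v 2 = 0) (hu3 : b.repr u 3 = 0)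
    (hv3 : b.repr v 3 = -1) : False := by
  have hb := h.isFacetBasis
  obtain ⟨u0, v0⟩ := h.repr_ge hV (i := 0) (by omega)
  obtain ⟨u1, v1⟩ := h.repr_ge hV (i := 1) (by omega)
  have su := h.u_height
  have sv := h.v_height
  have sq := h.q_height
  unfold height at su sv sq
  have s0 := h.sum_eq 0
  have s1 := h.sum_eq 1
  have cu : ¬ b.repr u 0 = 0 := fun h0 => by
    apply ne_neg_basis hV hb h.u_mem (by rw [h.u_height]; norm_num) 2 hu2
    intro j hj
    fin_cases j <;> simp at hj ⊢ <;> omega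
  have cv : ¬ b.repr v 0 = 0 := fun h0 => by
    apply ne_neg_basis hV hb h.v_mem (by rw [h.v_height]; norm_num) 3 hv3
    intro j hj
    fin_cases j <;> simp at hj ⊢ <;> omega
  have cuv : ¬ b.repr u 0 + b.repr v 0 = 0 := fun h0 => by
    apply hV.add_notMem u h.u_mem v h.v_mem h.u_ne_v
    have hsum : u + v = q := by
      apply eq_of_coords b <;> rw [map_add, Finsupp.add_apply] <;> linarith
    exact hsum ▸ h.q_mem
  -- The coordinates of `u` at 0 and 1 are opposite, as are those of `v`. They are nonzero and at
  -- least -1, hence `±1`. Since `u + v ≠ q`, the signs at index 0 agree, so the zero sum gives `q`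
  -- the entries 2 and -2.
  have hq : b.repr q 0 = -2 ∨ b.repr q 1 = -2 := by omega
  rcases hq with hq | hq
  · exact h.q_repr_ne hV hx0 hx2 hq hq2
  · have e0 : Equiv.swap (0 : Fin 4) 1 2 = 2 := by decide
    exact (h.reindex (Equiv.swap 0 1)).q_repr_ne hV (by simpa using hx1) (by simpa [e0] using hx2)
      (by simpa using hq) (by simpa [e0] using hq2)

/-- The two remaining coordinates of `v` are at least -1 and sum to -1, so `v` could only be `-b 0`
or `-b 1`. -/
lemma false_of_same (hV : IsNeighbourlyConfig V) (h : IsOneZero V b x u v q)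
    (hx0 : b.repr x 0 = -1) (hx1 : b.repr x 1 = -1)
    (hv2 : b.repr v 2 = 0) (hv3 : b.repr v 3 = 0) : False := by
  have hb := h.isFacetBasis
  obtain ⟨u0, v0⟩ := h.repr_ge hV (i := 0) (by omega)
  obtain ⟨u1, v1⟩ := h.repr_ge hV (i := 1) (by omega)
  have sv := h.v_height
  unfold height at sv
  have hle : height b v ≤ 0 := by rw [h.v_height]; norm_num
  have : b.repr v 0 = -1 ∧ b.repr v 1 = 0 ∨ b.repr v 0 = 0 ∧ b.repr v 1 = -1 ∨
    b.repr v 0 = 1 ∨ b.repr v 1 = 1 := by omega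
  rcases this with ⟨h0, h1⟩ | ⟨h0, h1⟩ | h0 | h0
  · apply ne_neg_basis hV hb h.v_mem hle 0 h0
    intro j hj
    fin_cases j <;> simp at hj ⊢ <;> omega
  · apply ne_neg_basis hV hb h.v_mem hle 1 h1
    intro j hj
    fin_cases j <;> simp at hj ⊢ <;> omega
  · omega
  · omega

/-- By `repr_cases` a nonnegative coordinate of `x` is 0 or 1, so height 0 forces `x = (-1, -1, 1,
1)`. At each of the indices 2 and 3 exactly one of `u`, `v` is then -1: either the same vertex twice
or each of them once. -/
lemma false_of_neg (hV : IsNeighbourlyConfig V) (h : IsOneZero V b x u v q)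
    (h0 : b.repr x 0 < 0) (h1 : b.repr x 1 < 0) : False := by
  have g0 := repr_ge_of_height_zero hV h.isFacetBasis h.x_mem h.x_height 0
  have g1 := repr_ge_of_height_zero hV h.isFacetBasis h.x_mem h.x_height 1
  have g2 := repr_ge_of_height_zero hV h.isFacetBasis h.x_mem h.x_height 2
  have g3 := repr_ge_of_height_zero hV h.isFacetBasis h.x_mem h.x_height 3
  have sx := h.x_height
  unfold height at sx
  have hx0 : b.repr x 0 = -1 := by omega
  have hx1 : b.repr x 1 = -1 := by omega
  have c2 : 0 ≤ b.repr x 2 → _ := h.repr_cases hV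
  have c3 : 0 ≤ b.repr x 3 → _ := h.repr_cases hV
  have n2 : 0 ≤ b.repr x 2 := by
    by_contra hn
    have := c3 (by omega)
    omega
  have n3 : 0 ≤ b.repr x 3 := by
    by_contra hn
    have := c2 (by omega)
    omega
  rcases c2 n2 with d2 | ⟨x2, q2, d2⟩
  · have := c3 n3; omega
  rcases c3 n3 with d3 | ⟨x3, q3, d3⟩
  · omega
  rcases d2 with ⟨u2, v2⟩ | ⟨u2, v2⟩ <;> rcases d3 with ⟨u3, v3⟩ | ⟨u3, v3⟩
  · exact h.false_of_same hV hx0 hx1 v2 v3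
  · exact h.false_of_split hV hx0 hx1 x2 q2 q3 u2 v2 u3 v3
  · exact h.swap.false_of_split hV hx0 hx1 x2 q2 q3 v2 u2 v3 u3
  · exact h.swap.false_of_same hV hx0 hx1 u2 u3

end IsOneZero

end OneZero

/-- A permutation moving two given indices to the first two places. -/
lemma exists_perm_zero_one {i j : Fin 4} (hij : i ≠ j) :
    ∃ σ : Equiv.Perm (Fin 4), σ i = 0 ∧ σ j = 1 := by
  revert i j
  decide

lemma not_isOneZero (hV : IsNeighbourlyConfig V) {x u v q : M} (h : IsOneZero V b x u v q) :
    False := by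
  obtain ⟨i, j, hij, hi, hj⟩ := exists_two_neg hV h.isFacetBasis h.x_mem (Or.inl h.x_height)
    (repr_ge_of_height_zero hV h.isFacetBasis h.x_mem h.x_height)
  obtain ⟨σ, hσi, hσj⟩ := exists_perm_zero_one hij
  refine (h.reindex σ).false_of_neg hV ?_ ?_
  · rw [Module.Basis.repr_reindex_apply, ← hσi]; simpa using hi
  · rw [Module.Basis.repr_reindex_apply, ← hσj]; simpa using hj

/-- Two vertices of height zero can be brought to normal form. -/
lemma exists_isZeroPair (hV : IsNeighbourlyConfig V) (hb : IsFacetBasis V b) {x y : M}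
    (hx : x ∈ V) (hy : y ∈ V) (hxy : x ≠ y) (hx0 : height b x = 0) (hy0 : height b y = 0) :
    ∃ σ : Equiv.Perm (Fin 4), IsZeroPair V (b.reindex σ) x y := by
  obtain ⟨i, j, hij, hi, hj⟩ := exists_two_neg hV hb hx (Or.inl hx0)
    (repr_ge_of_height_zero hV hb hx hx0)
  obtain ⟨σ, hσi, hσj⟩ := exists_perm_zero_one hij
  refine ⟨σ, ?_⟩
  have hb' := hb.reindex σ
  rw [← height_reindex b σ] at hx0 hy0
  have hi' : (b.reindex σ).repr x 0 < 0 := by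
    rw [Module.Basis.repr_reindex_apply, ← hσi]; simpa using hi
  have hj' : (b.reindex σ).repr x 1 < 0 := by
    rw [Module.Basis.repr_reindex_apply, ← hσj]; simpa using hj
  generalize b.reindex σ = c at *
  have d : ∀ i, c.repr x i < 0 → ¬ c.repr y i < 0 :=
    fun i h1 h2 => hxy (eq_of_repr_neg hV hb' hx hy hx0 hy0 h1 h2)
  have y0 := d 0 hi'
  have y1 := d 1 hj'
  have hc := zero_height_cases hV hb' hy hy0
  have y2 : c.repr y 2 < 0 := by omega
  have y3 : c.repr y 3 < 0 := by omega
  have x2 : ¬ c.repr x 2 < 0 := fun h' => d 2 h' y2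
  have x3 : ¬ c.repr x 3 < 0 := fun h' => d 3 h' y3
  have gx := repr_ge_of_height_zero hV hb' hx hx0
  have gy := repr_ge_of_height_zero hV hb' hy hy0
  have := gx 0
  have := gx 1
  have := gy 2
  have := gy 3
  unfold height at hx0 hy0
  constructor <;> first | assumption | omega

lemma card_le_seven (hV : IsNeighbourlyConfig V) : V.card ≤ 7 := by
  classical
  by_contra! hcard
  obtain ⟨b, hb, hs⟩ := exists_special_facet hV (∑ v ∈ V, v)
  set B := V.filter fun v => 0 < height b v with hB
  set Z := V.filter fun v => height b v = 0 with hZ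
  set N := V.filter fun v => height b v < 0 with hN
  have hBeq : B = Finset.univ.image b := by
    ext v
    simp only [hB, Finset.mem_filter, Finset.mem_image, Finset.mem_univ, true_and]
    constructor
    · rintro ⟨hv, h⟩
      by_contra hv'
      exact absurd (hb.height_nonpos v hv hv') (by omega)
    · rintro ⟨i, rfl⟩
      exact ⟨hb.mem i, by rw [height_basis]; norm_num⟩
  have hsplit : ∀ {α : Type} [AddCommMonoid α] (f : M → α),
      ∑ v ∈ V, f v = ∑ v ∈ B, f v + (∑ v ∈ Z, f v + ∑ v ∈ N, f v) := by
    intro α _ f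
    rw [← Finset.sum_filter_add_sum_filter_not V (fun v => 0 < height b v), ← hB,
      ← Finset.sum_filter_add_sum_filter_not (V.filter fun v => ¬ 0 < height b v)
        (fun v => height b v = 0), Finset.filter_filter, Finset.filter_filter, hZ, hN]
    congr 3
    · ext v
      simp only [Finset.mem_filter]
      constructor
      · rintro ⟨h1, h2, h3⟩; exact ⟨h1, h3⟩
      · rintro ⟨h1, h2⟩; exact ⟨h1, by omega, h2⟩
    · ext v
      simp only [Finset.mem_filter]
      constructor
      · rintro ⟨h1, h2, h3⟩; exact ⟨h1, by omega⟩
      · rintro ⟨h1, h2⟩; exact ⟨h1, by omega, by omega⟩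
  have hBsum : ∀ f : M → ℤ, ∑ v ∈ B, f v = ∑ i, f (b i) := by
    intro f
    rw [hBeq, Finset.sum_image fun i _ j _ h => b.injective h]
  have hcard' : V.card = 4 + (Z.card + N.card) := by
    have h1 := hsplit (fun _ => (1 : ℕ))
    simp only [Finset.sum_const, smul_eq_mul, mul_one] at h1
    rw [h1, hBeq, Finset.card_image_of_injective _ b.injective]
    rfl
  have hcoord : ∀ i, b.repr (∑ v ∈ V, v) i =
      1 + (∑ v ∈ Z, b.repr v i + ∑ v ∈ N, b.repr v i) := by
    intro i
    rw [map_sum, Finsupp.finsetSum_apply, hsplit, hBsum]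
    congr 1
    simp [Finsupp.single_apply]
  have hheight : height b (∑ v ∈ V, v) = 4 + ∑ v ∈ N, height b v := by
    rw [height_sum, hsplit, hBsum, Finset.sum_eq_zero (s := Z)
      (fun v hv => (Finset.mem_filter.1 hv).2)]
    simp [height_basis]
  have hs0 := hs 0
  have hs1 := hs 1
  have hs2 := hs 2
  have hs3 := hs 3
  -- The sum `s` lies in the facet cone, so its height, 4 plus the heights in `N`, is nonnegative.
  have hge : -4 ≤ ∑ v ∈ N, height b v := by
    unfold height at hheight
    simp only [height]
    omega
  have hNmem : ∀ v, v ∈ N ↔ v ∈ V ∧ height b v < 0 := fun v => Finset.mem_filter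
  have hZmem : ∀ v, v ∈ Z ↔ v ∈ V ∧ height b v = 0 := fun v => Finset.mem_filter
  have hZ2 : Z.card ≤ 2 := card_height_zero_le hV hb
  -- A vector of height 0 in the facet cone vanishes.
  have hs_zero : ∑ v ∈ N, height b v = -4 →
      ∀ i, 1 + (∑ v ∈ Z, b.repr v i + ∑ v ∈ N, b.repr v i) = 0 := by
    intro h4 i
    rw [← hcoord]
    unfold height at hheight h4
    fin_cases i <;> simp only [Fin.zero_eta, Fin.mk_one, Fin.reduceFinMk] <;> omega
  have hNle : ∀ v ∈ N, height b v ≤ -1 := fun v hv => by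
    have := ((hNmem v).1 hv).2
    omega
  obtain hz | hz | hz : Z.card = 2 ∨ Z.card = 1 ∨ Z.card = 0 := by omega
  · obtain ⟨x, y, hxy, hZeq⟩ := Finset.card_eq_two.1 hz
    obtain ⟨hx, hx0⟩ := (hZmem x).1 (by simp [hZeq])
    obtain ⟨hy, hy0⟩ := (hZmem y).1 (by simp [hZeq])
    obtain ⟨σ, hpair⟩ := exists_isZeroPair hV hb hx hy hxy hx0 hy0
    have hN2 : ∀ v ∈ N, height b v ≤ -2 := by
      intro v hv
      have h1 := hNle v hv
      have h2 := hpair.height_ne_neg_one hV ((hNmem v).1 hv).1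
      rw [height_reindex] at h2
      omega
    have hle : ∑ v ∈ N, height b v ≤ N.card • (-2) := Finset.sum_le_card_nsmul N _ _ hN2
    rw [nsmul_eq_mul] at hle
    -- At least two vertices of height at most -2, of total at least -4: exactly two, both of height
    -- -2.
    obtain ⟨w, w', hww', hNeq⟩ := Finset.card_eq_two.1 (show N.card = 2 by omega)
    have hw := hN2 w (by simp [hNeq])
    have hw' := hN2 w' (by simp [hNeq])
    have hsum := hge
    rw [hNeq, Finset.sum_pair hww'] at hsum
    have h0 := hs_zero (by rw [hNeq, Finset.sum_pair hww']; omega)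
    rw [hZeq, hNeq] at h0
    simp only [Finset.sum_pair hww', Finset.sum_pair hxy] at h0
    have h0' : ∀ i, 1 + ((b.reindex σ).repr x i + (b.reindex σ).repr y i +
        ((b.reindex σ).repr w i + (b.reindex σ).repr w' i)) = 0 := fun i => by
      simpa only [Module.Basis.repr_reindex_apply] using h0 (σ.symm i)
    have p0 := h0' 0
    have p1 := h0' 1
    have p2 := h0' 2
    have p3 := h0' 3
    have l0 := hpair.left_zero
    have l1 := hpair.left_one
    have l2 := hpair.right_two
    have l3 := hpair.right_three
    refine hpair.not_two_height_neg_two hV ((hNmem w).1 (by simp [hNeq])).1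
      ((hNmem w').1 (by simp [hNeq])).1 ?_ ?_ hww' ?_ ?_ ?_ ?_
    · rw [height_reindex]; omega
    · rw [height_reindex]; omega
    all_goals omega
  · obtain ⟨x, hZeq⟩ := Finset.card_eq_one.1 hz
    obtain ⟨hx, hx0⟩ := (hZmem x).1 (by simp [hZeq])
    have hxu : ∀ z ∈ V, height b z = 0 → z = x := fun z hz hz0 => by
      have := (hZmem z).2 ⟨hz, hz0⟩
      simpa [hZeq] using this
    by_cases hall : ∀ v ∈ N, height b v = -1
    -- The contribution 1 of the facet absorbs the at most one -1 from `N`, so `s` dominates the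
    -- nonnegative coordinates of `x`. These sum to at least 2, as `x` has two negative coordinates
    -- and height 0. But `N` has at least three elements, so `s` has height at most 1.
    · have hsi : ∀ i, 0 ≤ b.repr x i → b.repr x i ≤ b.repr (∑ v ∈ V, v) i := by
        intro i hi
        obtain ⟨b', hadj⟩ := exists_isAdjacent hV hb i
        have h1 := sum_repr_ge hadj (hadj.height_new_neg hb hxu hi) N
          (fun w hw => ⟨((hNmem w).1 hw).1, hall w hw⟩)
        rw [hcoord, hZeq, Finset.sum_singleton]
        omega
      have hle : ∑ v ∈ N, height b v ≤ N.card • (-1) := Finset.sum_le_card_nsmul N _ _ hNle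
      rw [nsmul_eq_mul] at hle
      have q0 := hsi 0
      have q1 := hsi 1
      have q2 := hsi 2
      have q3 := hsi 3
      have hc := zero_height_cases hV hb hx hx0
      rw [height] at hheight hx0
      omega
    · push Not at hall
      obtain ⟨q, hq, hq1⟩ := hall
      have hq2 := hNle q hq
      have hsum := Finset.add_sum_erase N (height b) hq
      have hle : ∑ v ∈ N.erase q, height b v ≤ (N.erase q).card • (-1) :=
        Finset.sum_le_card_nsmul _ _ _ (fun v hv => hNle v (Finset.mem_of_mem_erase hv))
      rw [nsmul_eq_mul] at hle
      have hce := Finset.card_erase_of_mem hq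
      -- With at least three negative heights, one of them at most -2, the bound -4 leaves only -2,
      -- -1, -1.
      obtain ⟨u, v, huv, hNeq⟩ := Finset.card_eq_two.1 (show (N.erase q).card = 2 by omega)
      have hu : u ∈ N := Finset.mem_of_mem_erase (a := q) (by simp [hNeq])
      have hv : v ∈ N := Finset.mem_of_mem_erase (a := q) (by simp [hNeq])
      have hu1 := hNle u hu
      have hv1 := hNle v hv
      rw [hNeq, Finset.sum_pair huv] at hsum
      have h0 := hs_zero (by omega)
      refine not_isOneZero hV (x := x) (u := u) (v := v) (q := q) (b := b)
        ⟨hb, hx, ((hNmem u).1 hu).1, ((hNmem v).1 hv).1, ((hNmem q).1 hq).1, hx0, by omega,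
          by omega, by omega, huv, hxu, ?_, ?_⟩
      · intro z hz hz0
        by_cases hzq : z = q
        · exact Or.inr (Or.inr hzq)
        · have := Finset.mem_erase.2 ⟨hzq, (hNmem z).2 ⟨hz, hz0⟩⟩
          rw [hNeq, Finset.mem_insert, Finset.mem_singleton] at this
          tauto
      · intro i
        have := h0 i
        rw [hZeq, Finset.sum_singleton, ← Finset.add_sum_erase N _ hq, hNeq,
          Finset.sum_pair huv] at this
        omega
  · have hZeq := Finset.card_eq_zero.1 hz
    -- Here `N` has at least four elements and total height at least -4.
    have hone : ∀ v ∈ N, height b v = -1 := by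
      intro v hv
      have hsum := Finset.add_sum_erase N (height b) hv
      have hle : ∑ w ∈ N.erase v, height b w ≤ (N.erase v).card • (-1) :=
        Finset.sum_le_card_nsmul _ _ _ (fun v hv => hNle v (Finset.mem_of_mem_erase hv))
      rw [nsmul_eq_mul] at hle
      have hce := Finset.card_erase_of_mem hv
      have := hNle v hv
      omega
    have hkey : ∀ i, ∃ p, b.repr p i = -1 ∧ ∀ v ∈ N, v ≠ p → 0 ≤ b.repr v i := by
      intro i
      obtain ⟨b', hadj⟩ := exists_isAdjacent hV hb i
      have hlt : height b (b' i) < 0 := by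
        refine lt_of_le_of_ne (hadj.height_new_nonpos hb) fun h0 => ?_
        have := (hZmem _).2 ⟨hadj.isFacetBasis.mem i, h0⟩
        simp [hZeq] at this
      exact ⟨b' i, hadj.repr_new, fun v hv hne =>
        hadj.repr_nonneg_of_height_neg_one hlt ((hNmem v).1 hv).1 (hone v hv) hne⟩
    have hle := card_le_two_of_disjoint_neg (b := b) N ?_ ?_
    · omega
    · intro v hv
      refine exists_two_neg hV hb ((hNmem v).1 hv).1 (Or.inr (hone v hv)) fun i => ?_
      obtain ⟨p, hp, h⟩ := hkey i
      by_cases hvp : v = p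
      · rw [hvp, hp]
      · have := h v hv hvp
        omega
    · intro v hv w hw i hi hi'
      obtain ⟨p, hp, h⟩ := hkey i
      have h1 : v = p := by
        by_contra hne
        have := h v hv hne
        omega
      have h2 : w = p := by
        by_contra hne
        have := h w hw hne
        omega
      rw [h1, h2]

end Combinatorics

/-! ### Faces, edges and primitive pairs -/

section Polytopes

variable {d : ℕ} {P F : Set (Fin d → ℝ)}

namespace IsConvexPolytope

lemma finite_vertexSet (hP : IsConvexPolytope P) : (vertexSet P).Finite := by
  obtain ⟨S, hS, rfl⟩ := hP
  exact hS.subset (extremePoints_convexHull_subset (𝕜 := ℝ))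

lemma convex (hP : IsConvexPolytope P) : Convex ℝ P := by
  obtain ⟨S, hS, rfl⟩ := hP
  exact convex_convexHull ℝ S

lemma isCompact (hP : IsConvexPolytope P) : IsCompact P := by
  obtain ⟨S, hS, rfl⟩ := hP
  exact hS.isCompact_convexHull ℝ

lemma convexHull_vertexSet (hP : IsConvexPolytope P) : convexHull ℝ (vertexSet P) = P := by
  rw [← (hP.finite_vertexSet.isClosed_convexHull ℝ).closure_eq]
  exact closure_convexHull_extremePoints hP.isCompact hP.convex

lemma le_of_vertexSet (hP : IsConvexPolytope P) {f : (Fin d → ℝ) →L[ℝ] ℝ} {c : ℝ}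
    (h : ∀ v ∈ vertexSet P, f v ≤ c) : ∀ x ∈ P, f x ≤ c := by
  intro x hx
  rw [← hP.convexHull_vertexSet] at hx
  exact convexHull_min (t := {x | f x ≤ c}) h (convex_halfSpace_le f.isLinear c) hx

end IsConvexPolytope

lemma vertexSet_subset : vertexSet P ⊆ P := extremePoints_subset

lemma IsFace.vertexSet_eq (hF : IsFace P F) : vertexSet F = F ∩ vertexSet P :=
  hF.2.isExtreme.extremePoints_eq

/-- A linear functional bounded by `c` on `P` and attaining `c` defines a face. -/
lemma isFace_of_functional {f : (Fin d → ℝ) →L[ℝ] ℝ} {c : ℝ} (h : ∀ x ∈ P, f x ≤ c)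
    (hc : ∃ x ∈ P, f x = c) : IsFace P {x ∈ P | f x = c} := by
  obtain ⟨x, hx, hxc⟩ := hc
  refine ⟨⟨x, hx, hxc⟩, fun _ => ⟨f, ?_⟩⟩
  ext y
  constructor
  · rintro ⟨hy, hyc⟩
    exact ⟨hy, fun z hz => hyc ▸ h z hz⟩
  · rintro ⟨hy, hyc⟩
    exact ⟨hy, le_antisymm (h y hy) (hxc ▸ hyc x hx)⟩

lemma IsFace.exists_functional (hF : IsFace P F) : ∃ (f : (Fin d → ℝ) →L[ℝ] ℝ) (c : ℝ),
    (∀ x ∈ P, f x ≤ c) ∧ F = {x ∈ P | f x = c} := by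
  obtain ⟨⟨x, hx⟩, hexp⟩ := hF
  obtain ⟨f, hf⟩ := hexp ⟨x, hx⟩
  rw [hf] at hx
  refine ⟨f, f x, hx.2, ?_⟩
  rw [hf]
  ext y
  constructor
  · rintro ⟨hy, hyc⟩
    exact ⟨hy, le_antisymm (hx.2 y hy) (hyc x hx.1)⟩
  · rintro ⟨hy, hyc⟩
    exact ⟨hy, fun z hz => hyc ▸ hx.2 z hz⟩

/-- The interior point 0 is a local maximum of `f`, and the derivative there is `f` itself. -/
lemma functional_eq_zero_of_nonpos (h0 : (0 : Fin d → ℝ) ∈ interior P) {f : (Fin d → ℝ) →L[ℝ] ℝ}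
    (h : ∀ x ∈ P, f x ≤ 0) : f = 0 := by
  have hmax : IsLocalMax f 0 := by
    filter_upwards [mem_interior_iff_mem_nhds.1 h0] with x hx
    simpa using h x hx
  exact hmax.hasFDerivAt_eq_zero f.hasFDerivAt

namespace IsFanoPolyhedron

lemma zero_mem (hP : IsFanoPolyhedron P) : (0 : Fin d → ℝ) ∈ P :=
  interior_subset hP.zero_mem_interior

lemma zero_notMem_vertexSet (hd : 0 < d) (hP : IsFanoPolyhedron P) : (0 : Fin d → ℝ) ∉ vertexSet P := by
  have : Nonempty (Fin d) := ⟨⟨0, hd⟩⟩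
  exact Set.disjoint_left.1 (disjoint_interior_extremePoints P) hP.zero_mem_interior

lemma exists_pos (hP : IsFanoPolyhedron P) {f : (Fin d → ℝ) →L[ℝ] ℝ} (hf : f ≠ 0) :
    ∃ v ∈ vertexSet P, 0 < f v := by
  by_contra! h
  exact hf (functional_eq_zero_of_nonpos hP.zero_mem_interior (hP.isConvexPolytope.le_of_vertexSet h))

/-- A functional on a Fano polyhedron defining a proper face. -/
lemma isProperFace (hP : IsFanoPolyhedron P) {f : (Fin d → ℝ) →L[ℝ] ℝ} {c : ℝ} (hc : 0 < c)
    (h : ∀ v ∈ vertexSet P, f v ≤ c) (hv : ∃ v ∈ vertexSet P, f v = c) :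
    IsProperFace P {x ∈ P | f x = c} ∧
      vertexSet {x ∈ P | f x = c} = {v ∈ vertexSet P | f v = c} := by
  obtain ⟨v, hv, hvc⟩ := hv
  have hF := isFace_of_functional (hP.isConvexPolytope.le_of_vertexSet h)
    ⟨v, vertexSet_subset hv, hvc⟩
  refine ⟨⟨hF, fun h' => ?_⟩, ?_⟩
  · have := hP.zero_mem
    rw [← h'] at this
    have := this.2
    rw [map_zero] at this
    exact hc.ne this
  · rw [hF.vertexSet_eq]
    ext x
    exact ⟨fun hx => ⟨hx.2, hx.1.2⟩, fun hx => ⟨⟨vertexSet_subset hx.1, hx.2⟩, hx.1⟩⟩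

lemma exists_functional (hP : IsFanoPolyhedron P) (hF : IsProperFace P F) :
    ∃ (f : (Fin d → ℝ) →L[ℝ] ℝ) (c : ℝ), 0 < c ∧ (∀ x ∈ P, f x ≤ c) ∧
      F = {x ∈ P | f x = c} := by
  obtain ⟨f, c, hle, rfl⟩ := hF.1.exists_functional
  refine ⟨f, c, lt_of_le_of_ne (by simpa using hle 0 hP.zero_mem) fun hc => hF.2 ?_, hle, rfl⟩
  subst hc
  rw [functional_eq_zero_of_nonpos hP.zero_mem_interior hle]
  ext x
  simp

lemma exists_isProperFace_of_vertex (hd : 0 < d) (hP : IsFanoPolyhedron P) {v : Fin d → ℝ}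
    (hv : v ∈ vertexSet P) : ∃ F, IsProperFace P F ∧ v ∈ F := by
  have : Nonempty (Fin d) := ⟨⟨0, hd⟩⟩
  have hvi : v ∉ interior P := fun h =>
    Set.disjoint_left.1 (disjoint_interior_extremePoints P) h hv
  obtain ⟨f, hf⟩ := geometric_hahn_banach_open_point hP.isConvexPolytope.convex.interior
    isOpen_interior hvi
  have hle : ∀ x ∈ P, f x ≤ f v := by
    intro x hx
    have h1 : x ∈ closure (interior P) := by
      rw [hP.isConvexPolytope.convex.closure_interior_eq_closure_of_nonempty_interior
        ⟨0, hP.zero_mem_interior⟩]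
      exact subset_closure hx
    exact closure_minimal (t := {x | f x ≤ f v}) (fun y hy => (hf y hy).le)
      (isClosed_le f.continuous continuous_const) h1
  have hpos : 0 < f v := by simpa using hf 0 hP.zero_mem_interior
  exact ⟨_, (hP.isProperFace hpos (fun x hx => hle x (vertexSet_subset hx)) ⟨v, hv, rfl⟩).1,
    vertexSet_subset hv, rfl⟩

/-- A vertex lying in the cone over a proper face lies in that face. -/
lemma mem_of_mem_faceCone (hd : 0 < d) (hP : IsFanoPolyhedron P) (hF : IsProperFace P F)
    {v : Fin d → ℝ} (hv : v ∈ vertexSet P) (hvF : v ∈ faceCone F) : v ∈ F := by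
  obtain ⟨f, c, hc, hle, hFeq⟩ := hP.exists_functional hF
  have hconv : Convex ℝ F := hF.1.2.convex hP.isConvexPolytope.convex
  obtain ⟨y₀, hy₀⟩ := hF.1.1
  have key : ∀ x ∈ faceCone F, ∃ r : ℝ, 0 ≤ r ∧ ∃ y ∈ F, x = r • y := by
    intro x hx
    refine Submodule.span_induction (p := fun x _ => ∃ r : ℝ, 0 ≤ r ∧ ∃ y ∈ F, x = r • y)
      ?_ ?_ ?_ ?_ hx
    · intro x hx
      exact ⟨1, zero_le_one, x, vertexSet_subset hx, (one_smul _ _).symm⟩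
    · exact ⟨0, le_rfl, y₀, hy₀, (zero_smul _ _).symm⟩
    · rintro _ _ _ _ ⟨r, hr, y, hy, rfl⟩ ⟨s, hs, z, hz, rfl⟩
      rcases (add_nonneg hr hs).eq_or_lt with h0 | h0
      · have hr0 : r = 0 := by linarith
        have hs0 : s = 0 := by linarith
        exact ⟨0, le_rfl, y₀, hy₀, by simp [hr0, hs0]⟩
      · refine ⟨r + s, h0.le, (r / (r + s)) • y + (s / (r + s)) • z,
          hconv hy hz (by positivity) (by positivity) (by field_simp), ?_⟩
        rw [smul_add, smul_smul, smul_smul, mul_div_cancel₀ _ h0.ne', mul_div_cancel₀ _ h0.ne']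
    · rintro a _ _ ⟨r, hr, y, hy, rfl⟩
      exact ⟨a * r, mul_nonneg a.2 hr, y, hy, by rw [mul_smul]; rfl⟩
  obtain ⟨r, hr, y, hy, rfl⟩ := key v hvF
  have hyP : y ∈ P ∧ f y = c := by rw [hFeq] at hy; exact hy
  -- `v = r • y` with `f v ≤ c = f y`, so `v` lies on the segment from 0 to `y`; extremality leaves
  -- only `v = y`.
  have hr1 : r ≤ 1 := by
    have := hle _ (vertexSet_subset hv)
    rw [map_smul, hyP.2, smul_eq_mul] at this
    nlinarith
  have hseg : r • y ∈ segment ℝ 0 y := ⟨1 - r, r, by linarith, hr, by ring, by simp⟩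
  rcases (mem_extremePoints_iff_forall_segment.1 hv).2 0 hP.zero_mem y hyP.1 hseg with h | h
  · exact absurd (h ▸ hv) (hP.zero_notMem_vertexSet hd)
  · exact h ▸ hy

/-- The vertices lie on a hyperplane `f = c` with `c ≠ 0`, where a linear relation has coefficient
sum 0 and is thus an affine one. -/
lemma linearIndepOn_vertexSet (hP : IsFanoPolyhedron P) (hF : IsProperFace P F) :
    LinearIndepOn ℝ id (vertexSet F) := by
  obtain ⟨f, c, hc, hle, hFeq⟩ := hP.exists_functional hF
  have haff := affineIndependent_iff.1 (hP.simplicial F hF).1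
  refine linearIndependent_iff'.2 fun s w hw i hi => ?_
  have hval : ∀ v : vertexSet F, f (v : Fin d → ℝ) = c := fun v => by
    have h : (v : Fin d → ℝ) ∈ {x ∈ P | f x = c} := hFeq ▸ vertexSet_subset v.2
    exact h.2
  have h1 := congrArg f hw
  simp only [map_sum, map_smul, map_zero, id_eq, hval, smul_eq_mul, ← Finset.sum_mul] at h1
  exact haff s w ((mul_eq_zero.1 h1).resolve_right hc.ne') hw i hi

/-- Two vertices on a common proper face are joined by an edge. -/
lemma joinedByEdge_of_mem (hP : IsFanoPolyhedron P) (hF : IsProperFace P F) {v w : Fin d → ℝ}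
    (hv : v ∈ vertexSet P) (hw : w ∈ vertexSet P) (hvF : v ∈ F) (hwF : w ∈ F) (hvw : v ≠ w) :
    JoinedByEdge P v w := by
  classical
  have hli := hP.linearIndepOn_vertexSet hF
  obtain ⟨f, c, hc, hle, hFeq⟩ := hP.exists_functional hF
  have hvert := hF.1.vertexSet_eq
  -- Linear independence lets `g` single out `v` and `w` on the face. A small tilt of `f` by `g`
  -- then exposes a face with just these two vertices, and simpliciality makes it the segment.
  obtain ⟨g, hg⟩ : ∃ g : (Fin d → ℝ) →L[ℝ] ℝ,
      ∀ u ∈ vertexSet F, g u = if u = v ∨ u = w then 1 else 0 := by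
    let B := Module.Basis.extend hli
    refine ⟨LinearMap.toContinuousLinearMap
      (B.constr ℝ fun u => if (u : Fin d → ℝ) = v ∨ (u : Fin d → ℝ) = w then 1 else 0), ?_⟩
    intro u hu
    have h1 : B ⟨u, hli.subset_extend _ hu⟩ = u := Module.Basis.extend_apply_self hli _
    conv_lhs => rw [← h1]
    rw [LinearMap.coe_toContinuousLinearMap', Module.Basis.constr_basis]
  have hvF' : v ∈ vertexSet F := by rw [hvert]; exact ⟨hvF, hv⟩
  have hwF' : w ∈ vertexSet F := by rw [hvert]; exact ⟨hwF, hw⟩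
  have hgv : g v = 1 := by rw [hg v hvF']; simp
  have hgw : g w = 1 := by rw [hg w hwF']; simp
  have hfv : f v = c := by rw [hFeq] at hvF; exact hvF.2
  have hfw : f w = c := by rw [hFeq] at hwF; exact hwF.2
  obtain ⟨t, ht, ht0⟩ : ∃ t : ℝ, (∀ u ∈ vertexSet P, f u < c → f u + t * g u < c + t) ∧ 0 < t := by
    have h1 : ∀ᶠ t : ℝ in nhdsWithin 0 (Set.Ioi 0),
        ∀ u ∈ vertexSet P, f u < c → f u + t * g u < c + t := by
      rw [Filter.eventually_all_finite hP.isConvexPolytope.finite_vertexSet]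
      intro u _
      by_cases hu : f u < c
      · have hcont : ContinuousAt (fun t : ℝ => c + t - (f u + t * g u)) 0 := by fun_prop
        have h2 := hcont.eventually (lt_mem_nhds (show 0 < c + 0 - (f u + 0 * g u) by linarith))
        filter_upwards [nhdsWithin_le_nhds h2] with t ht _
        linarith
      · exact Filter.Eventually.of_forall fun t h => absurd h hu
    exact (h1.and self_mem_nhdsWithin).exists
  have hmem : ∀ u ∈ vertexSet P, f u = c → u ∈ vertexSet F := fun u hu hfu => by
    rw [hvert, hFeq]; exact ⟨⟨vertexSet_subset hu, hfu⟩, hu⟩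
  have hfun : ∀ u, (f + t • g) u = f u + t * g u := fun u => rfl
  have hbound : ∀ u ∈ vertexSet P, (f + t • g) u ≤ c + t := by
    intro u hu
    rw [hfun]
    rcases (hle u (vertexSet_subset hu)).lt_or_eq with h | h
    · exact (ht u hu h).le
    · rw [h, hg u (hmem u hu h)]
      split_ifs <;> linarith
  obtain ⟨hG, hGv⟩ := hP.isProperFace (f := f + t • g) (c := c + t) (by linarith) hbound
    ⟨v, hv, by rw [hfun, hfv, hgv, mul_one]⟩
  have hGv' : {x ∈ vertexSet P | (f + t • g) x = c + t} = {v, w} := by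
    ext u
    constructor
    · rintro ⟨hu, hu'⟩
      rw [hfun] at hu'
      rcases (hle u (vertexSet_subset hu)).lt_or_eq with h | h
      · exact absurd hu' (ht u hu h).ne
      · rw [h, hg u (hmem u hu h)] at hu'
        by_contra hne
        rw [if_neg (show ¬ (u = v ∨ u = w) from hne)] at hu'
        linarith
    · rintro (rfl | rfl)
      · exact ⟨hv, by rw [hfun, hfv, hgv, mul_one]⟩
      · exact ⟨hw, by rw [hfun, hfw, hgw, mul_one]⟩
  have hseg := (hP.simplicial _ hG).2
  rw [hGv, hGv', convexHull_pair] at hseg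
  refine ⟨hseg ▸ hG.1, ?_⟩
  rw [faceDim, vectorSpan_segment]
  exact finrank_span_singleton (sub_ne_zero.2 hvw.symm)

lemma faceDim_self (hP : IsFanoPolyhedron P) : faceDim P = d := by
  rw [faceDim, AffineSubspace.vectorSpan_eq_top_of_affineSpan_eq_top _ _ _
    (affineSpan_eq_top_of_nonempty_interior (s := P) ?_), finrank_top, Module.finrank_fin_fun]
  rw [hP.isConvexPolytope.convex.convexHull_eq]
  exact ⟨0, hP.zero_mem_interior⟩

/-- In dimension 1 the edge would be the whole polytope. -/
lemma isProperFace_of_joinedByEdge (hd : d ≠ 1) (hP : IsFanoPolyhedron P) {v w : Fin d → ℝ}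
    (h : JoinedByEdge P v w) : IsProperFace P (segment ℝ v w) :=
  ⟨h.1, fun h' => hd (by rw [← hP.faceDim_self, ← h', h.2])⟩

lemma mem_pair_of_mem_segment {v w x : Fin d → ℝ} (hv : v ∈ vertexSet P) (hw : w ∈ vertexSet P)
    (hx : x ∈ vertexSet P) (h : x ∈ segment ℝ v w) : x = v ∨ x = w := by
  have := (mem_extremePoints_iff_forall_segment.1 hx).2 v (vertexSet_subset hv) w
    (vertexSet_subset hw) h
  tauto

lemma exists_edge_functional (hd : d ≠ 1) (hP : IsFanoPolyhedron P) {v w : Fin d → ℝ}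
    (hv : v ∈ vertexSet P) (hw : w ∈ vertexSet P) (h : JoinedByEdge P v w) :
    ∃ (f : (Fin d → ℝ) →L[ℝ] ℝ) (c : ℝ), 0 < c ∧ f v = c ∧ f w = c ∧
      ∀ x ∈ vertexSet P, f x ≤ c ∧ (f x = c → x = v ∨ x = w) := by
  obtain ⟨f, c, hc, hle, hF⟩ := hP.exists_functional (hP.isProperFace_of_joinedByEdge hd h)
  have h1 := left_mem_segment ℝ v w
  have h2 := right_mem_segment ℝ v w
  rw [hF] at h1 h2
  refine ⟨f, c, hc, h1.2, h2.2, fun x hx => ⟨hle x (vertexSet_subset hx), fun hxc => ?_⟩⟩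
  apply mem_pair_of_mem_segment hv hw hx
  rw [hF]
  exact ⟨vertexSet_subset hx, hxc⟩

lemma mem_faceCone {v : Fin d → ℝ} (hF : IsProperFace P F) (hv : v ∈ vertexSet P) (hvF : v ∈ F) :
    v ∈ faceCone F := by
  apply PointedCone.subset_hull
  rw [hF.1.vertexSet_eq]
  exact ⟨hvF, hv⟩

/-- Primitive collections with two elements are the pairs of vertices not joined by an edge. -/
lemma exists_primitive_pair_iff (hd : 2 ≤ d) (hP : IsFanoPolyhedron P) :
    (∃ C, IsPrimitiveCollection P C ∧ C.ncard = 2) ↔ ¬ IsTwoNeighbourly P := by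
  have hd0 : 0 < d := by omega
  constructor
  · rintro ⟨C, hC, hC2⟩ hN
    obtain ⟨v, w, hvw, rfl⟩ := Set.ncard_eq_two.1 hC2
    have hv := hC.subset_vertexSet (Set.mem_insert v _)
    have hw := hC.subset_vertexSet (Set.mem_insert_of_mem v rfl)
    have hF := hP.isProperFace_of_joinedByEdge (by omega) (hN v hv w hw hvw)
    refine hC.not_subset_cone _ (Or.inr ⟨_, hF, rfl⟩) ?_
    rintro x (rfl | rfl)
    · exact mem_faceCone hF hv (left_mem_segment ℝ _ _)
    · exact mem_faceCone hF hw (right_mem_segment ℝ _ _)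
  · intro hN
    unfold IsTwoNeighbourly at hN
    push Not at hN
    obtain ⟨v, hv, w, hw, hvw, hne⟩ := hN
    have hsingle : ∀ x ∈ vertexSet P, ∃ σ ∈ polyhedralFan P, x ∈ σ := by
      intro x hx
      obtain ⟨F, hF, hxF⟩ := hP.exists_isProperFace_of_vertex hd0 hx
      exact ⟨_, Or.inr ⟨F, hF, rfl⟩, mem_faceCone hF hx hxF⟩
    refine ⟨{v, w}, ⟨?_, ?_, ?_⟩, Set.ncard_pair hvw⟩
    · rintro x (rfl | rfl) <;> assumption
    · rintro σ (rfl | ⟨F, hF, rfl⟩) hsub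
      · have : v = 0 := hsub (Set.mem_insert v _)
        exact hP.zero_notMem_vertexSet hd0 (this ▸ hv)
      · exact hne (hP.joinedByEdge_of_mem hF hv hw
          (hP.mem_of_mem_faceCone hd0 hF hv (hsub (Set.mem_insert v _)))
          (hP.mem_of_mem_faceCone hd0 hF hw (hsub (Set.mem_insert_of_mem v rfl))) hvw)
    · intro D hD
      obtain ⟨hsub, hnot⟩ := hD
      have : D ⊆ {v} ∨ D ⊆ {w} := by
        by_contra! h
        obtain ⟨h1, h2⟩ := h
        obtain ⟨x, hx, hxv⟩ := Set.not_subset.1 h1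
        obtain ⟨y, hy, hyw⟩ := Set.not_subset.1 h2
        have hx' : x = w := (hsub hx).resolve_left hxv
        have hy' : y = v := (hsub hy).resolve_right hyw
        subst hx' hy'
        exact hnot (by rintro z (rfl | rfl) <;> assumption)
      rcases this with h | h
      · obtain ⟨σ, hσ, hvσ⟩ := hsingle v hv
        exact ⟨σ, hσ, fun x hx => by rw [h hx]; exact hvσ⟩
      · obtain ⟨σ, hσ, hvσ⟩ := hsingle w hw
        exact ⟨σ, hσ, fun x hx => by rw [h hx]; exact hvσ⟩

end IsFanoPolyhedron

end Polytopes

/-! ### From the polytope to lattice bases -/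

section Lattice

/-- The inclusion of `ℤ^d` into `ℝ^d`. -/
def toRealLattice (d : ℕ) : (Fin d → ℤ) →ₗ[ℤ] (Fin d → ℝ) where
  toFun z i := z i
  map_add' x y := by ext; simp
  map_smul' c x := by ext; simp

lemma toRealLattice_injective (d : ℕ) : Function.Injective (toRealLattice d) := by
  intro x y h
  ext i
  exact Int.cast_injective (α := ℝ) (congrFun h i)

/-- The real extension of an integral functional. -/
noncomputable def extendFunctional {d : ℕ} (φ : (Fin d → ℤ) →ₗ[ℤ] ℤ) : (Fin d → ℝ) →L[ℝ] ℝ :=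
  ∑ k, (φ (Pi.single k 1) : ℝ) • ContinuousLinearMap.proj k

lemma extendFunctional_apply {d : ℕ} (φ : (Fin d → ℤ) →ₗ[ℤ] ℤ) (z : Fin d → ℤ) :
    extendFunctional φ (toRealLattice d z) = φ z := by
  have h : z = ∑ k, z k • (Pi.single k 1 : Fin d → ℤ) := by
    ext i
    simp [Finset.sum_apply, Pi.single_apply]
  conv_rhs => rw [h, map_sum, Int.cast_sum]
  rw [extendFunctional, sum_apply]
  refine Finset.sum_congr rfl fun k _ => ?_
  rw [map_smul, smul_eq_mul, Int.cast_mul, mul_comm]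
  rfl

lemma functional_apply_lattice {d : ℕ} {ι : Type*} [Fintype ι] (b : Module.Basis ι ℤ (Fin d → ℤ))
    (h : (Fin d → ℝ) →L[ℝ] ℝ) (z : Fin d → ℤ) :
    h (toRealLattice d z) = ∑ i, (b.repr z i : ℝ) * h (toRealLattice d (b i)) := by
  conv_lhs => rw [← b.sum_repr z, map_sum, map_sum]
  refine Finset.sum_congr rfl fun i _ => ?_
  rw [map_smul, ← Int.cast_smul_eq_zsmul ℝ, map_smul, smul_eq_mul]

lemma functional_eq_zero_of_lattice {d : ℕ} {ι : Type*} [Fintype ι]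
    (b : Module.Basis ι ℤ (Fin d → ℤ)) {h : (Fin d → ℝ) →L[ℝ] ℝ}
    (hb : ∀ i, h (toRealLattice d (b i)) = 0) : h = 0 := by
  have hz : ∀ z, h (toRealLattice d z) = 0 := fun z => by
    rw [functional_apply_lattice b]
    simp [hb]
  ext x
  have hx : x = ∑ k, x k • toRealLattice d (Pi.single k 1) := by
    ext i
    simp [toRealLattice, Finset.sum_apply, Pi.single_apply]
  rw [hx, map_sum]
  simp [hz]

variable {P : Set (Fin 4 → ℝ)}

/-- A functional bounded by `1` on the vertices can be moved in a given direction until the bound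
is attained at a further vertex. -/
lemma exists_perturbation (hfin : (vertexSet P).Finite)
    {f g : (Fin 4 → ℝ) →L[ℝ] ℝ}
    (hf : ∀ v ∈ vertexSet P, f v ≤ 1) (hg : ∃ v ∈ vertexSet P, 0 < g v) :
    ∃ t : ℝ, (∀ v ∈ vertexSet P, (f + t • g) v ≤ 1) ∧
      ∃ v ∈ vertexSet P, 0 < g v ∧ (f + t • g) v = 1 := by
  obtain ⟨v₀, hv₀, hg₀⟩ := hg
  -- Ratio test: the first vertex reached has the least quotient of slack by growth rate.
  obtain ⟨v, ⟨hv, hgv⟩, hmin⟩ := Set.exists_min_image {v ∈ vertexSet P | 0 < g v}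
    (fun v => (1 - f v) / g v) (hfin.subset fun v hv => hv.1) ⟨v₀, hv₀, hg₀⟩
  refine ⟨(1 - f v) / g v, fun u hu => ?_, v, hv, hgv, ?_⟩
  · change f u + (1 - f v) / g v * g u ≤ 1
    rcases lt_or_ge 0 (g u) with h | h
    · have := hmin u ⟨hu, h⟩
      rw [le_div_iff₀ h] at this
      linarith
    · have h1 : 0 ≤ (1 - f v) / g v := div_nonneg (by linarith [hf v hv]) hgv.le
      have := mul_nonpos_of_nonneg_of_nonpos h1 h
      linarith [hf u hu]
  · change f v + (1 - f v) / g v * g v = 1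
    rw [div_mul_cancel₀ _ hgv.ne']
    ring

namespace IsFanoPolyhedron

/-- The directions of `F` together with one point of `F` span the space by `hspan`, while `f` kills
the directions but not the point. -/
lemma faceDim_eq_three {f : (Fin 4 → ℝ) →L[ℝ] ℝ} {F : Set (Fin 4 → ℝ)} {v₀ : Fin 4 → ℝ}
    (hv₀ : v₀ ∈ F) (hF : ∀ x ∈ F, f x = 1)
    (hspan : ∀ h : (Fin 4 → ℝ) →L[ℝ] ℝ, (∀ x ∈ F, h x = 0) → h = 0) : faceDim F + 1 = 4 := by
  have htop : vectorSpan ℝ F ⊔ Submodule.span ℝ {v₀} = ⊤ := by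
    by_contra hne
    obtain ⟨h, h0, hle⟩ := Submodule.exists_le_ker_of_lt_top _ (lt_top_iff_ne_top.2 hne)
    have hv : h v₀ = 0 := hle (le_sup_right (a := vectorSpan ℝ F)
      (Submodule.mem_span_singleton_self v₀))
    have := hspan (LinearMap.toContinuousLinearMap h) fun x hx => by
      have h1 : h (x - v₀) = 0 := hle (le_sup_left (a := vectorSpan ℝ F)
        (vsub_mem_vectorSpan ℝ hx hv₀))
      rw [map_sub, hv, sub_zero] at h1
      exact h1
    exact h0 (LinearMap.toContinuousLinearMap.injective (by simpa using this))
  have hker : vectorSpan ℝ F ≤ LinearMap.ker (f : (Fin 4 → ℝ) →ₗ[ℝ] ℝ) := by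
    rw [vectorSpan_def, Submodule.span_le]
    rintro _ ⟨x, hx, y, hy, rfl⟩
    simp [hF x hx, hF y hy]
  have hlt : vectorSpan ℝ F < ⊤ := by
    refine lt_top_iff_ne_top.2 fun h => ?_
    have : v₀ ∈ vectorSpan ℝ F := h ▸ Submodule.mem_top
    have h1 : f v₀ = 0 := hker this
    rw [hF v₀ hv₀] at h1
    exact one_ne_zero h1
  have h1 := Submodule.finrank_lt hlt.ne
  have h2 := Submodule.finrank_add_le_finrank_add_finrank (vectorSpan ℝ F)
    (Submodule.span ℝ {v₀})
  have h3 := finrank_span_le_card (R := ℝ) ({v₀} : Set (Fin 4 → ℝ))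
  rw [htop, finrank_top, Module.finrank_fin_fun] at h2
  rw [Module.finrank_fin_fun] at h1
  simp only [Set.toFinset_singleton, Finset.card_singleton] at h3
  unfold faceDim
  omega

/-- A functional bounded by `1` on `P` whose level set `1` contains enough vertices defines a
facet. -/
lemma exists_facet_basis (hP : IsFanoPolyhedron P) {f : (Fin 4 → ℝ) →L[ℝ] ℝ}
    (hle : ∀ v ∈ vertexSet P, f v ≤ 1)
    (hspan : ∀ h : (Fin 4 → ℝ) →L[ℝ] ℝ, (∀ v ∈ vertexSet P, f v = 1 → h v = 0) → h = 0) :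
    ∃ b : Module.Basis (Fin 4) ℤ (Fin 4 → ℤ), ∀ z,
      (toRealLattice 4 z ∈ vertexSet P ∧ f (toRealLattice 4 z) = 1) ↔ z ∈ Set.range b := by
  have hex : ∃ v ∈ vertexSet P, f v = 1 := by
    by_contra! h
    have := hspan (ContinuousLinearMap.proj 0) fun v hv hv1 => absurd hv1 (h v hv)
    have := congrArg (fun l : (Fin 4 → ℝ) →L[ℝ] ℝ => l 1) this
    simp at this
  obtain ⟨hF, hvert⟩ := hP.isProperFace one_pos hle hex
  obtain ⟨v₀, hv₀, hv₀1⟩ := hex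
  obtain ⟨A, hA, hrange⟩ := hP.facet_basis _ hF
    (faceDim_eq_three (f := f) ⟨vertexSet_subset hv₀, hv₀1⟩ (fun x hx => hx.2)
      fun h hh => hspan h fun v hv hv1 => hh v ⟨vertexSet_subset hv, hv1⟩)
  let r : Fin 4 → Fin 4 → ℤ := fun i j => A i j
  have hunit : IsUnit ((Pi.basisFun ℤ (Fin 4)).det r) := by
    rw [Pi.basisFun_det_apply]
    change IsUnit A.det
    rcases hA with h | h <;> rw [h]
    · exact isUnit_one
    · exact isUnit_one.neg
  obtain ⟨hli, hsp⟩ := (Module.Basis.is_basis_iff_det (Pi.basisFun ℤ (Fin 4))).2 hunit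
  refine ⟨Module.Basis.mk hli hsp.ge, fun z => ?_⟩
  rw [Module.Basis.coe_mk]
  have h1 : (toRealLattice 4 z ∈ vertexSet P ∧ f (toRealLattice 4 z) = 1) ↔
      toRealLattice 4 z ∈ vertexSet {x ∈ P | f x = 1} := by rw [hvert]; rfl
  rw [h1, hrange]
  constructor
  · rintro ⟨i, hi⟩
    exact ⟨i, toRealLattice_injective 4 hi⟩
  · rintro ⟨i, rfl⟩
    exact ⟨i, rfl⟩

lemma exists_lattice_vertices (hP : IsFanoPolyhedron P) : ∃ V : Finset (Fin 4 → ℤ),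
    (∀ z, z ∈ V ↔ toRealLattice 4 z ∈ vertexSet P) ∧ V.card = (vertexSet P).ncard := by
  have hfin := hP.isConvexPolytope.finite_vertexSet.preimage
    ((toRealLattice_injective 4).injOn (s := toRealLattice 4 ⁻¹' vertexSet P))
  refine ⟨hfin.toFinset, fun z => by simp, ?_⟩
  rw [← Set.ncard_eq_toFinset_card _ hfin, ← Set.ncard_image_of_injective _
    (toRealLattice_injective 4), Set.image_preimage_eq_of_subset]
  intro v hv
  obtain ⟨z, rfl⟩ := hP.vertex_integral v hv
  exact ⟨z, rfl⟩

/-- On lattice points `f` equals the integral height, so a vertex off the facet has height less than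
1 and hence at most 0. -/
lemma isFacetBasis_of_functional {V : Finset (Fin 4 → ℤ)}
    (hV : ∀ z, z ∈ V ↔ toRealLattice 4 z ∈ vertexSet P) {f : (Fin 4 → ℝ) →L[ℝ] ℝ}
    (hle : ∀ v ∈ vertexSet P, f v ≤ 1) {b : Module.Basis (Fin 4) ℤ (Fin 4 → ℤ)}
    (hb : ∀ z, (toRealLattice 4 z ∈ vertexSet P ∧ f (toRealLattice 4 z) = 1) ↔ z ∈ Set.range b) :
    IsFacetBasis V b := by
  have hmem := fun i => (hb (b i)).2 ⟨i, rfl⟩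
  refine ⟨fun i => (hV _).2 (hmem i).1, fun z hz hzb => ?_⟩
  have hfz : f (toRealLattice 4 z) = height b z := by
    rw [functional_apply_lattice b, height_eq_sum]
    simp [(hmem _).2]
  have hz' := (hV z).1 hz
  have h1 := hle _ hz'
  have h2 : f (toRealLattice 4 z) ≠ 1 := fun h => hzb ((hb z).1 ⟨hz', h⟩)
  have h3 := lt_of_le_of_ne h1 h2
  rw [hfz] at h3
  have : height b z < 1 := by exact_mod_cast h3
  omega

/-- Take a functional, at most 1 on the vertices, that is 1 at as many of them as possible. If a
nonzero functional vanished on that level set, tilting along it would gain a vertex. -/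
lemma exists_isFacetBasis (hP : IsFanoPolyhedron P) {V : Finset (Fin 4 → ℤ)}
    (hV : ∀ z, z ∈ V ↔ toRealLattice 4 z ∈ vertexSet P) :
    ∃ b : Module.Basis (Fin 4) ℤ (Fin 4 → ℤ), IsFacetBasis V b := by
  have hfin := hP.isConvexPolytope.finite_vertexSet
  let count : ((Fin 4 → ℝ) →L[ℝ] ℝ) → ℕ := fun f => {v ∈ vertexSet P | f v = 1}.ncard
  have hbdd : BddAbove (count '' {f | ∀ v ∈ vertexSet P, f v ≤ 1}) := by
    refine ⟨(vertexSet P).ncard, ?_⟩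
    rintro _ ⟨f, -, rfl⟩
    exact Set.ncard_le_ncard (fun v hv => hv.1) hfin
  have hne : (count '' {f | ∀ v ∈ vertexSet P, f v ≤ 1}).Nonempty :=
    ⟨_, 0, fun v _ => by simp, rfl⟩
  obtain ⟨f, hf, hmax⟩ := Nat.sSup_mem hne hbdd
  obtain ⟨b, hb⟩ := hP.exists_facet_basis hf fun h hh => by
    by_contra h0
    obtain ⟨t, hle, v, hv, hhv, hv1⟩ := exists_perturbation hfin hf (hP.exists_pos h0)
    have hlt : count f < count (f + t • h) := by
      refine Set.ncard_lt_ncard ⟨?_, fun hsub => ?_⟩ (hfin.subset fun v hv => hv.1)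
      · rintro u ⟨hu, hu1⟩
        refine ⟨hu, ?_⟩
        change f u + t * h u = 1
        rw [hu1, hh u hu hu1, mul_zero, add_zero]
      · have := hh v hv (hsub ⟨hv, hv1⟩).2
        exact hhv.ne' this
    have := le_csSup hbdd ⟨f + t • h, hle, rfl⟩
    omega
  exact ⟨b, isFacetBasis_of_functional hV hf hb⟩

/-- Rotate the height functional around the ridge opposite `b i` until it meets a new vertex `z`.
Its `i`-th coordinate is negative, so `z` and the ridge span, and the new level set is a facet. -/
lemma exists_adjacent_basis (hP : IsFanoPolyhedron P) {V : Finset (Fin 4 → ℤ)}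
    (hV : ∀ z, z ∈ V ↔ toRealLattice 4 z ∈ vertexSet P)
    {b : Module.Basis (Fin 4) ℤ (Fin 4 → ℤ)} (hb : IsFacetBasis V b) (i : Fin 4) :
    ∃ b' : Module.Basis (Fin 4) ℤ (Fin 4 → ℤ),
      IsFacetBasis V b' ∧ b' i ≠ b i ∧ ∀ j, j ≠ i → b' j = b j := by
  have hfin := hP.isConvexPolytope.finite_vertexSet
  have hint : ∀ v ∈ vertexSet P, ∃ z ∈ V, v = toRealLattice 4 z := fun v hv => by
    obtain ⟨z, rfl⟩ := hP.vertex_integral v hv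
    exact ⟨z, (hV z).2 hv, rfl⟩
  set f := extendFunctional (∑ j, b.coord j) with hf
  set g := extendFunctional (-b.coord i) with hg
  have hfz : ∀ z, f (toRealLattice 4 z) = height b z := fun z => by
    rw [hf, extendFunctional_apply, height_eq_sum]
    simp
  have hgz : ∀ z, g (toRealLattice 4 z) = -(b.repr z i : ℝ) := fun z => by
    rw [hg, extendFunctional_apply]
    simp
  have hfle : ∀ v ∈ vertexSet P, f v ≤ 1 := by
    intro v hv
    obtain ⟨z, hz, rfl⟩ := hint v hv
    rw [hfz]
    by_cases hzb : z ∈ Set.range b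
    · obtain ⟨j, rfl⟩ := hzb
      rw [height_basis]; norm_num
    · have := hb.height_nonpos z hz hzb
      have : (height b z : ℝ) ≤ 0 := by exact_mod_cast this
      linarith
  have hg0 : g ≠ 0 := fun h => by
    have := hgz (b i)
    simp [h] at this
  obtain ⟨t, hle, v, hv, hgv, hv1⟩ := exists_perturbation hfin hfle (hP.exists_pos hg0)
  obtain ⟨z, hz, rfl⟩ := hint v hv
  have hbj : ∀ j, j ≠ i → (f + t • g) (toRealLattice 4 (b j)) = 1 := fun j hj => by
    change f _ + t * g _ = 1
    rw [hfz, hgz, height_basis, b.repr_self, Finsupp.single_eq_of_ne hj.symm]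
    simp
  rw [hgz] at hgv
  have hzi : (b.repr z i : ℝ) ≠ 0 := by intro h; rw [h] at hgv; simp at hgv
  obtain ⟨c, hc⟩ := hP.exists_facet_basis hle fun h hh => by
    have hj : ∀ j, j ≠ i → h (toRealLattice 4 (b j)) = 0 := fun j hj =>
      hh _ ((hV _).1 (hb.mem j)) (hbj j hj)
    have hi := hh _ hv hv1
    rw [functional_apply_lattice b, Finset.sum_eq_single i (fun j _ hji => by
      rw [hj j hji, mul_zero]) (by simp)] at hi
    refine functional_eq_zero_of_lattice b fun j => ?_
    by_cases hji : j = i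
    · rw [hji]; exact (mul_eq_zero.1 hi).resolve_left hzi
    · exact hj j hji
  have hzne : ∀ j, j ≠ i → z ≠ b j := by
    rintro j hj rfl
    rw [b.repr_self, Finsupp.single_eq_of_ne hj.symm] at hzi
    simp at hzi
  have hrange : ∀ j, Function.update b i z j ∈ Set.range c := by
    intro j
    rw [← hc]
    by_cases hji : j = i
    · subst hji
      rw [Function.update_self]
      exact ⟨hv, hv1⟩
    · rw [Function.update_of_ne hji]
      exact ⟨(hV _).1 (hb.mem j), hbj j hji⟩
  choose σ hσ using hrange
  have hinj : Function.Injective σ := by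
    have : Function.Injective (Function.update b i z) := by
      intro j k hjk
      by_cases hji : j = i <;> by_cases hki : k = i
      · rw [hji, hki]
      · subst hji
        rw [Function.update_self, Function.update_of_ne hki] at hjk
        exact absurd hjk (hzne k hki)
      · subst hki
        rw [Function.update_self, Function.update_of_ne hji] at hjk
        exact absurd hjk.symm (hzne j hji)
      · rw [Function.update_of_ne hji, Function.update_of_ne hki] at hjk
        exact b.injective hjk
    exact fun j k h => this (by rw [← hσ j, ← hσ k, h])
  -- The facet basis comes in arbitrary order; reindexing puts `z` in place `i` and keeps the other
  -- vertices in theirs.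
  let e := Equiv.ofBijective σ (Finite.injective_iff_bijective.1 hinj)
  have hval : ∀ j, c.reindex e.symm j = Function.update b i z j := fun j => by
    rw [Module.Basis.reindex_apply]
    exact hσ j
  refine ⟨c.reindex e.symm, (isFacetBasis_of_functional hV hle hc).reindex _, ?_, fun j hj => ?_⟩
  · rw [hval, Function.update_self]
    rintro rfl
    rw [b.repr_self, Finsupp.single_eq_same] at hgv
    norm_num at hgv
  · rw [hval, Function.update_of_ne hj]

lemma isNeighbourlyConfig (hP : IsFanoPolyhedron P) (hN : IsTwoNeighbourly P)
    {V : Finset (Fin 4 → ℤ)} (hV : ∀ z, z ∈ V ↔ toRealLattice 4 z ∈ vertexSet P) :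
    IsNeighbourlyConfig V := by
  have hedge : ∀ v ∈ V, ∀ w ∈ V, v ≠ w → ∃ (f : (Fin 4 → ℝ) →L[ℝ] ℝ) (c : ℝ), 0 < c ∧
      f (toRealLattice 4 v) = c ∧ f (toRealLattice 4 w) = c ∧
      ∀ x ∈ V, f (toRealLattice 4 x) ≤ c ∧ (f (toRealLattice 4 x) = c → x = v ∨ x = w) := by
    intro v hv w hw hvw
    rw [hV] at hv hw
    obtain ⟨f, c, hc, hfv, hfw, hle⟩ := hP.exists_edge_functional (by norm_num) hv hw
      (hN _ hv _ hw ((toRealLattice_injective 4).ne hvw))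
    refine ⟨f, c, hc, hfv, hfw, fun x hx => ?_⟩
    have := hle _ ((hV x).1 hx)
    rwa [(toRealLattice_injective 4).eq_iff, (toRealLattice_injective 4).eq_iff] at this
  refine ⟨hP.exists_isFacetBasis hV, fun b hb i => hP.exists_adjacent_basis hV hb i, ?_, ?_, ?_⟩
  · intro v hv w hw hvw h0
    obtain ⟨f, c, hc, hfv, hfw, hle⟩ := hedge v hv w hw hvw
    have := congrArg (fun z => f (toRealLattice 4 z)) h0
    simp only [map_add, map_zero, hfv, hfw] at this
    linarith
  · intro v hv w hw hvw hmem
    obtain ⟨f, c, hc, hfv, hfw, hle⟩ := hedge v hv w hw hvw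
    have := (hle _ hmem).1
    simp only [map_add, hfv, hfw] at this
    linarith
  · intro v hv w hw hvw x hx y hy hxy
    obtain ⟨f, c, hc, hfv, hfw, hle⟩ := hedge v hv w hw hvw
    have := congrArg (fun z => f (toRealLattice 4 z)) hxy
    simp only [map_add, hfv, hfw] at this
    have hfx := (hle x hx).1
    have hfy := (hle y hy).1
    exact (hle x hx).2 (by linarith)

/-- A `2`-neighbourly Fano `4`-polyhedron has at most seven vertices. -/
lemma ncard_vertexSet_le (hP : IsFanoPolyhedron P) (hN : IsTwoNeighbourly P) :
    (vertexSet P).ncard ≤ 7 := by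
  obtain ⟨V, hV, hcard⟩ := hP.exists_lattice_vertices
  rw [← hcard]
  exact card_le_seven (hP.isNeighbourlyConfig hN hV)

/-- A vertex is not counted among its neighbours, since the segment from it to itself has dimension
0. -/
lemma valence_lt (hP : IsFanoPolyhedron P) {v : Fin 4 → ℝ} (hv : v ∈ vertexSet P) :
    valence P v < (vertexSet P).ncard := by
  refine Set.ncard_lt_ncard ⟨fun w hw => hw.1, fun hsub => ?_⟩
    hP.isConvexPolytope.finite_vertexSet
  have := (hsub hv).2.2
  rw [segment_same, faceDim, vectorSpan_singleton, finrank_bot] at this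
  exact zero_ne_one this

lemma vertexSet_nonempty (hP : IsFanoPolyhedron P) : (vertexSet P).Nonempty := by
  rw [← convexHull_nonempty_iff (𝕜 := ℝ), hP.isConvexPolytope.convexHull_vertexSet]
  exact ⟨0, hP.zero_mem⟩

end IsFanoPolyhedron

end Lattice

theorem mainTheorem7 (P : Set (Fin 4 → ℝ)) (hP : IsFanoPolyhedron P) :
    ((∀ v ∈ vertexSet P, 7 ≤ valence P v) →
      (∃ C, IsPrimitiveCollection P C ∧ C.ncard = 2) ∧ ¬ IsTwoNeighbourly P) ∧
    ((∃ C, IsPrimitiveCollection P C ∧ C.ncard = 2) ↔ ¬ IsTwoNeighbourly P) := by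
  have hiff := hP.exists_primitive_pair_iff (by norm_num)
  refine ⟨fun hval => ?_, hiff⟩
  have hN : ¬ IsTwoNeighbourly P := fun hN => by
    obtain ⟨v, hv⟩ := hP.vertexSet_nonempty
    have h1 := hval v hv
    have h2 := hP.valence_lt hv
    have h3 := hP.ncard_vertexSet_le hN
    omega
  exact ⟨hiff.2 hN, hN⟩
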